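/- Let $d\ge 1$ and let $V:\mathbb{C}^d\to\mathbb{C}^d\otimes\mathbb{C}^d$ be a linear isometry. For a partition $\mathcal I$ of $[0,1]$ into finitely many standard dyadic intervals $[p/2^n,(p+1)/2^n]$ put $\mathcal H_{\mathcal I}=(\mathbb{C}^d)^{\otimes|\mathcal I|}$, with one tensor factor for each interval. If $\mathcal J$ refines $\mathcal I$, let $\iota_{\mathcal J,\mathcal I}:\mathcal H_{\mathcal I}\to\mathcal H_{\mathcal J}$ be the isometry given by the tensor network of the binary forest with roots $\mathcal I$ and leaves $\mathcal J$, with $V$ at every inner node. Let $\mathcal H$ be the Hilbert space completion of the direct limit of the spaces $\mathcal H_{\mathcal I}$ along these maps. Let $\mathsf T$ be Thompson's group of homeomorphisms of $S^1=\mathbb{R}/\mathbb{Z}$ that are piecewise linear with finitely many breakpoints, all at dyadic rationals, with all slopes integer powers of $2$, and that map dyadic rationals to dyadic rationals. Let $\rho^V$ be the unitary representation of $\mathsf T$ on $\mathcal H$ determined as follows: if $f\in\mathsf T$ maps every interval of $\mathcal I$ affinely onto an interval of a standard dyadic partition $\mathcal J=f(\mathcal I)$, then $\rho^V(f)[\Psi]=[\Psi']$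 for $\Psi\in\mathcal H_{\mathcal I}$, where $\Psi'\in\mathcal H_{\mathcal J}$ is obtained from $\Psi$ by relabelling the tensor factors according to $f$. The representation $\rho^V$ is called weakly discontinuous at the identity if there are $f_k\in\mathsf T$ with $\|f_k-\mathrm{id}\|_\infty\to0$ (in the distance of $S^1$) and $\Phi,\Psi\in\mathcal H$ such that $\lim_{k\to\infty}\langle\Phi,\rho^V(f_k)\Psi\rangle$ exists and differs from $\langle\Phi,\Psi\rangle$. Let $\mathcal V=VV^\dagger(\mathbb{C}^d\otimes\mathbb{C}^d)$ and suppose that $$(\mathcal V\otimes\mathbb{C}^d)\cap(\mathbb{C}^d\otimes\mathcal V)=\{0\}.$$ Then $\rho^V$ is weakly discontinuous at the identity. More precisely, let $f_k\in\mathsf T$ be the translation by $2^{-k}$ and let $x=(I\otimes V^\dagger)(V\otimes I)$, an operator on $\mathbb{C}^d\otimes\mathbb{C}^d$. Then $\|f_k-\mathrm{id}\|_\infty\to0$ and $\|x\|<1$. Moreover, for all $\varphi,\psi\in\mathbb{C}^d$, with $\Phi,\Psi\in\mathcal H$ the classes of $\varphi,\psi$ regarded as elements of $\mathcal H_{\{[0,1]\}}=\mathbb{C}^d$,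 one has $\langle\Phi,\Psi\rangle=\langle\varphi,\psi\rangle$ and $\lim_{k\to\infty}\langle\Phi,\rho^V(f_k)\Psi\rangle=0$, and there is a constant $C$, independent of $k$, such that $$|\langle\Phi,\rho^V(f_{k+1})\Psi\rangle|\le C\,\|x\|^{2^{k}}\qquad\text{for all }k\ge0 .$$ -/

import Mathlib

open scoped TensorProduct

noncomputable section

namespace TreeRep

/-! ### Standard dyadic intervals and partitions -/

/-- The standard dyadic interval `[index / 2 ^ level, (index + 1) / 2 ^ level]` in `[0, 1]`. -/
@[ext] structure Dyadic where
  level : ℕ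
  index : ℕ
  index_lt : index < 2 ^ level
deriving DecidableEq

namespace Dyadic

/-- The interval without its right endpoint, so that the intervals of a partition are disjoint. -/
def toSet (A : Dyadic) : Set ℝ :=
  Set.Ico ((A.index : ℝ) / 2 ^ A.level) ((A.index + 1 : ℝ) / 2 ^ A.level)

/-- The left half of a standard dyadic interval. -/
def left (A : Dyadic) : Dyadic :=
  ⟨A.level + 1, 2 * A.index, by have := A.index_lt; rw [pow_succ]; omega⟩

/-- The right half of a standard dyadic interval. -/
def right (A : Dyadic) : Dyadic :=
  ⟨A.level + 1, 2 * A.index + 1, by have := A.index_lt; rw [pow_succ]; omega⟩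

theorem mem_iff (A : Dyadic) (x : ℝ) :
    x ∈ A.toSet ↔ (A.index : ℝ) ≤ x * 2 ^ A.level ∧ x * 2 ^ A.level < A.index + 1 := by
  have h : (0 : ℝ) < 2 ^ A.level := by positivity
  rw [toSet, Set.mem_Ico, div_le_iff₀ h, lt_div_iff₀ h]

theorem start_mem (A : Dyadic) : (A.index : ℝ) / 2 ^ A.level ∈ A.toSet := by
  rw [mem_iff, div_mul_cancel₀ _ (by positivity)]
  constructor <;> linarith

theorem sub_unit (A : Dyadic) {x : ℝ} (hx : x ∈ A.toSet) : x ∈ Set.Ico (0 : ℝ) 1 := by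
  rw [mem_iff] at hx
  have h : (0 : ℝ) < 2 ^ A.level := by positivity
  have h1 : ((A.index : ℝ) + 1) ≤ 2 ^ A.level := by exact_mod_cast A.index_lt
  have h0 : (0 : ℝ) ≤ A.index := by positivity
  constructor
  · by_contra hneg
    nlinarith
  · by_contra hneg
    nlinarith

theorem mem_left_or_right (A : Dyadic) (x : ℝ) :
    x ∈ A.toSet ↔ x ∈ A.left.toSet ∨ x ∈ A.right.toSet := by
  simp only [mem_iff, left, right, pow_succ]
  push_cast
  constructor
  · rintro ⟨h1, h2⟩
    rcases lt_or_ge (x * (2 ^ A.level * 2)) (2 * A.index + 1) with h | h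
    · left; constructor <;> linarith
    · right; constructor <;> linarith
  · rintro (⟨h1, h2⟩ | ⟨h1, h2⟩) <;> constructor <;> linarith

theorem not_left_and_right (A : Dyadic) (x : ℝ) (h : x ∈ A.left.toSet) (h' : x ∈ A.right.toSet) :
    False := by
  simp only [mem_iff, left, right] at h h'
  push_cast at h h'
  linarith [h.2, h'.1]

theorem index_eq_floor {A : Dyadic} {x : ℝ} (h : x ∈ A.toSet) : ⌊x * 2 ^ A.level⌋ = A.index := by
  rw [mem_iff] at h
  rw [Int.floor_eq_iff]
  exact_mod_cast h

theorem eq_of_level {A B : Dyadic} {x : ℝ} (hA : x ∈ A.toSet) (hB : x ∈ B.toSet)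
    (h : A.level = B.level) : A = B := by
  have h1 := index_eq_floor hA
  have h2 := index_eq_floor hB
  rw [h] at h1
  ext
  · exact h
  · have : (A.index : ℤ) = B.index := by rw [← h1, ← h2]
    exact_mod_cast this

theorem nested {A B : Dyadic} {x : ℝ} (hA : x ∈ A.toSet) (hB : x ∈ B.toSet)
    (h : A.level ≤ B.level) : B.toSet ⊆ A.toSet := by
  obtain ⟨k, hk⟩ := Nat.exists_eq_add_of_le h
  have key : ∀ y : ℝ, y ∈ B.toSet → ⌊y * 2 ^ A.level⌋ = (B.index : ℤ) / ((2 ^ k : ℕ) : ℤ) := by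
    intro y hy
    rw [← index_eq_floor hy, ← Int.floor_div_natCast, hk, pow_add]
    congr 1
    push_cast
    field_simp
  intro y hy
  have h1 := key y hy
  have h2 := index_eq_floor hA
  rw [key x hB] at h2
  rw [h2, Int.floor_eq_iff] at h1
  rw [mem_iff]
  exact_mod_cast h1

theorem level_le_of_subset {A B : Dyadic} (h : B.toSet ⊆ A.toSet) : A.level ≤ B.level := by
  have hb : ((B.index : ℝ) / 2 ^ B.level) < (B.index + 1) / 2 ^ B.level := by
    gcongr; linarith
  have h' := (Set.Ico_subset_Ico_iff hb).1 h
  by_contra hlt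
  push Not at hlt
  have h2 : (2 : ℝ) ^ B.level < 2 ^ A.level := pow_lt_pow_right₀ (by norm_num) hlt
  have e1 : (B.index + 1 : ℝ) / 2 ^ B.level - B.index / 2 ^ B.level = 1 / 2 ^ B.level := by ring
  have e2 : (A.index + 1 : ℝ) / 2 ^ A.level - A.index / 2 ^ A.level = 1 / 2 ^ A.level := by ring
  have e3 : (1 : ℝ) / 2 ^ A.level < 1 / 2 ^ B.level := by gcongr
  linarith [h'.1, h'.2]

theorem left_subset (A : Dyadic) : A.left.toSet ⊆ A.toSet :=
  fun x hx => (A.mem_left_or_right x).2 (Or.inl hx)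

theorem right_subset (A : Dyadic) : A.right.toSet ⊆ A.toSet :=
  fun x hx => (A.mem_left_or_right x).2 (Or.inr hx)

/-- A dyadic interval inside `A` is `A` or lies in exactly one of its halves. -/
theorem subset_cases {A B : Dyadic} (h : B.toSet ⊆ A.toSet) (hne : B ≠ A) :
    (B.toSet ⊆ A.left.toSet ∧ ¬ B.toSet ⊆ A.right.toSet) ∨
      (B.toSet ⊆ A.right.toSet ∧ ¬ B.toSet ⊆ A.left.toSet) := by
  have hb := B.start_mem
  have hl : A.level + 1 ≤ B.level := by
    rcases (level_le_of_subset h).lt_or_eq with h1 | h1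
    · exact h1
    · exact absurd (eq_of_level hb (h hb) h1.symm) hne
  rcases (A.mem_left_or_right _).1 (h hb) with h1 | h1
  · exact Or.inl ⟨nested h1 hb hl, fun h2 => not_left_and_right A _ h1 (h2 hb)⟩
  · exact Or.inr ⟨nested h1 hb hl, fun h2 => not_left_and_right A _ (h2 hb) h1⟩

end Dyadic

/-- A partition of `[0, 1]` into finitely many standard dyadic intervals. -/
structure Partition where
  parts : Finset Dyadic
  existsUnique_mem : ∀ x ∈ Set.Ico (0 : ℝ) 1, ∃! A, A ∈ parts ∧ x ∈ A.toSet

namespace Partition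

theorem eq_of_mem (I : Partition) {A B : Dyadic} {x : ℝ} (hA : A ∈ I.parts) (hB : B ∈ I.parts)
    (hxA : x ∈ A.toSet) (hxB : x ∈ B.toSet) : A = B :=
  (I.existsUnique_mem x (A.sub_unit hxA)).unique ⟨hA, hxA⟩ ⟨hB, hxB⟩

theorem eq_of_subset (I : Partition) {A B : Dyadic} (hA : A ∈ I.parts) (hB : B ∈ I.parts)
    (h : B.toSet ⊆ A.toSet) : B = A :=
  I.eq_of_mem hB hA B.start_mem (h B.start_mem)

/-- `I ≤ J` means that `J` refines `I`: every interval of `J` lies in an interval of `I`.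
Since both are partitions, this says that every interval of `I` is a union of intervals of `J`. -/
instance : Preorder Partition where
  le I J := ∀ B ∈ J.parts, ∃ A ∈ I.parts, B.toSet ⊆ A.toSet
  le_refl I B hB := ⟨B, hB, subset_rfl⟩
  le_trans I J K hIJ hJK C hC := by
    obtain ⟨B, hB, hCB⟩ := hJK C hC
    obtain ⟨A, hA, hBA⟩ := hIJ B hB
    exact ⟨A, hA, hCB.trans hBA⟩

theorem le_def {I J : Partition} :
    I ≤ J ↔ ∀ B ∈ J.parts, ∃ A ∈ I.parts, B.toSet ⊆ A.toSet := Iff.rfl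

/-- The partition into the `2 ^ N` intervals of length `2 ^ (-N)`. -/
def uniform (N : ℕ) : Partition where
  parts := Finset.univ.image fun p : Fin (2 ^ N) => ⟨N, p, p.2⟩
  existsUnique_mem x hx := by
    have h2 : (0 : ℝ) < 2 ^ N := by positivity
    have hx0 : 0 ≤ x * 2 ^ N := mul_nonneg hx.1 h2.le
    have hlt : ⌊x * 2 ^ N⌋₊ < 2 ^ N := by
      rw [Nat.floor_lt hx0]
      push_cast
      nlinarith [hx.2]
    refine ⟨⟨N, ⌊x * 2 ^ N⌋₊, hlt⟩, ⟨?_, ?_⟩, ?_⟩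
    · exact Finset.mem_image.2 ⟨⟨_, hlt⟩, Finset.mem_univ _, rfl⟩
    · rw [Dyadic.mem_iff]
      exact ⟨Nat.floor_le hx0, Nat.lt_floor_add_one _⟩
    · rintro B ⟨hB, hxB⟩
      obtain ⟨p, -, rfl⟩ := Finset.mem_image.1 hB
      refine Dyadic.eq_of_level hxB (B := ⟨N, ⌊x * 2 ^ N⌋₊, hlt⟩) ?_ rfl
      rw [Dyadic.mem_iff]
      exact ⟨Nat.floor_le hx0, Nat.lt_floor_add_one _⟩

theorem mem_uniform {N : ℕ} {A : Dyadic} : A ∈ (uniform N).parts ↔ A.level = N := by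
  constructor
  · intro h
    obtain ⟨p, -, rfl⟩ := Finset.mem_image.1 h
    rfl
  · rintro rfl
    exact Finset.mem_image.2 ⟨⟨A.index, A.index_lt⟩, Finset.mem_univ _, rfl⟩

/-- The largest level of an interval of the partition. -/
def depth (I : Partition) : ℕ := I.parts.sup Dyadic.level

theorem level_le_depth (I : Partition) {A : Dyadic} (h : A ∈ I.parts) : A.level ≤ I.depth :=
  Finset.le_sup (f := Dyadic.level) h

theorem le_uniform (I : Partition) {N : ℕ} (h : I.depth ≤ N) : I ≤ uniform N := by
  intro B hB
  obtain ⟨A, ⟨hA, hxA⟩, -⟩ := I.existsUnique_mem _ (B.sub_unit B.start_mem)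
  refine ⟨A, hA, Dyadic.nested hxA B.start_mem ?_⟩
  rw [mem_uniform.1 hB]
  exact (I.level_le_depth hA).trans h

instance : IsDirectedOrder Partition where
  directed I J := ⟨uniform (max I.depth J.depth), I.le_uniform (le_max_left _ _),
    J.le_uniform (le_max_right _ _)⟩

instance : Nonempty Partition := ⟨uniform 0⟩

/-- `A` is a union of intervals of `I`. -/
def Above (I : Partition) (A : Dyadic) : Prop :=
  ∀ B ∈ I.parts, ∀ x ∈ B.toSet, x ∈ A.toSet → B.toSet ⊆ A.toSet

theorem above_of_mem {I : Partition} {A : Dyadic} (h : A ∈ I.parts) : I.Above A := by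
  intro B hB x hxB hxA
  rw [I.eq_of_mem hB h hxB hxA]

theorem Above.level_le {I : Partition} {A : Dyadic} (h : I.Above A) : A.level ≤ I.depth := by
  obtain ⟨B, ⟨hB, hxB⟩, -⟩ := I.existsUnique_mem _ (A.sub_unit A.start_mem)
  exact (Dyadic.level_le_of_subset (h B hB _ hxB A.start_mem)).trans (I.level_le_depth hB)

theorem Above.halves {I : Partition} {A : Dyadic} (h : I.Above A) (hA : A ∉ I.parts) :
    I.Above A.left ∧ I.Above A.right := by
  have key : ∀ B ∈ I.parts, ∀ x ∈ B.toSet, x ∈ A.toSet →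
      (B.toSet ⊆ A.left.toSet ∨ B.toSet ⊆ A.right.toSet) := by
    intro B hB x hxB hxA
    rcases Dyadic.subset_cases (h B hB x hxB hxA) (fun e => hA (e ▸ hB)) with h1 | h1
    · exact Or.inl h1.1
    · exact Or.inr h1.1
  constructor
  · intro B hB x hxB hxA
    rcases key B hB x hxB (A.left_subset hxA) with h1 | h1
    · exact h1
    · exact (A.not_left_and_right x hxA (h1 hxB)).elim
  · intro B hB x hxB hxA
    rcases key B hB x hxB (A.right_subset hxA) with h1 | h1
    · exact (A.not_left_and_right x (h1 hxB) hxA).elim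
    · exact h1

/-- Induction along the binary tree below `A` whose leaves are the intervals of `I` in `A`. -/
theorem Above.induction {I : Partition} {P : Dyadic → Prop}
    (leaf : ∀ A ∈ I.parts, P A)
    (node : ∀ A, I.Above A → A ∉ I.parts → P A.left → P A.right → P A)
    {A : Dyadic} (h : I.Above A) : P A := by
  obtain ⟨n, hn⟩ : ∃ n, I.depth = A.level + n := Nat.exists_eq_add_of_le h.level_le
  induction n generalizing A with
  | zero =>
    by_cases hA : A ∈ I.parts
    · exact leaf A hA
    · have := (h.halves hA).1.level_le
      simp only [Dyadic.left] at this
      omega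
  | succ n ih =>
    by_cases hA : A ∈ I.parts
    · exact leaf A hA
    · obtain ⟨hl, hr⟩ := h.halves hA
      exact node A h hA (ih hl (by simp only [Dyadic.left]; omega))
        (ih hr (by simp only [Dyadic.right]; omega))

theorem above_of_le {I J : Partition} (h : I ≤ J) {A : Dyadic} (hA : I.Above A) : J.Above A := by
  intro C hC x hxC hxA
  obtain ⟨B, hB, hCB⟩ := h C hC
  exact hCB.trans (hA B hB x (hCB hxC) hxA)

end Partition

/-! ### Contraction of tree tensor networks -/

section Extend

variable {κ : Type*}

/-- Extension of a family of covectors at the intervals of `J` by zero to all dyadic intervals. -/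
def extend {J : Partition} (y : J.parts → κ → ℂ) (B : Dyadic) : κ → ℂ :=
  if h : B ∈ J.parts then y ⟨B, h⟩ else 0

theorem extend_of_mem {J : Partition} (y : J.parts → κ → ℂ) (B : J.parts) :
    extend y B = y B := by
  simp [extend]

theorem extend_update {J : Partition} [DecidableEq J.parts] (y : J.parts → κ → ℂ) (B : J.parts) (u : κ → ℂ) :
    extend (Function.update y B u) = Function.update (extend y) (B : Dyadic) u := by
  funext C
  by_cases hC : C = B
  · subst hC
    simp [extend]
  · rw [Function.update_of_ne hC]
    by_cases h : C ∈ J.parts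
    · have : (⟨C, h⟩ : J.parts) ≠ B := fun e => hC (congrArg Subtype.val e)
      simp [extend, h, Function.update_of_ne this]
    · simp [extend, h]

end Extend

section Contract

variable {κ : Type*} [Fintype κ] (v : κ → κ → κ → ℂ)

/-- Contraction of the binary tree below `A` whose leaves are the intervals of `J`, with the
tensor `v b c a` (left child `b`, right child `c`, root `a`) at every inner node and the covector
`y B` at the leaf `B`. The natural number bounds the number of generations. -/
def contractAux (J : Partition) (y : Dyadic → κ → ℂ) : ℕ → Dyadic → κ → ℂ
  | 0, A => if A ∈ J.parts then y A else 0
  | n + 1, A =>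
    if A ∈ J.parts then y A
    else fun a => ∑ b, ∑ c, v b c a *
      (contractAux J y n A.left b * contractAux J y n A.right c)

/-- Contraction of the whole binary tree below `A` with leaves in `J`. -/
def contract (J : Partition) (y : Dyadic → κ → ℂ) (A : Dyadic) : κ → ℂ :=
  contractAux v J y J.depth A

theorem contractAux_of_mem {J : Partition} (y : Dyadic → κ → ℂ) (n : ℕ) {A : Dyadic}
    (h : A ∈ J.parts) : contractAux v J y n A = y A := by
  cases n <;> simp [contractAux, h]

theorem contractAux_stable {J : Partition} (y : Dyadic → κ → ℂ) {A : Dyadic} (h : J.Above A) :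
    ∀ n m : ℕ, J.depth ≤ A.level + n → J.depth ≤ A.level + m →
      contractAux v J y n A = contractAux v J y m A := by
  refine Partition.Above.induction
    (P := fun A => ∀ n m : ℕ, J.depth ≤ A.level + n → J.depth ≤ A.level + m →
      contractAux v J y n A = contractAux v J y m A) ?_ ?_ h
  · intro A hA n m _ _
    rw [contractAux_of_mem v y n hA, contractAux_of_mem v y m hA]
  · intro A hab hA ihl ihr n m hn hm
    have hl := (hab.halves hA).1.level_le
    simp only [Dyadic.left] at hl
    obtain ⟨n, rfl⟩ : ∃ k, n = k + 1 := ⟨n - 1, by omega⟩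
    obtain ⟨m, rfl⟩ : ∃ k, m = k + 1 := ⟨m - 1, by omega⟩
    simp only [contractAux, hA, if_false]
    rw [ihl n m (by simp only [Dyadic.left]; omega) (by simp only [Dyadic.left]; omega),
      ihr n m (by simp only [Dyadic.right]; omega) (by simp only [Dyadic.right]; omega)]

theorem contract_leaf {J : Partition} (y : Dyadic → κ → ℂ) {A : Dyadic} (h : A ∈ J.parts) :
    contract v J y A = y A := contractAux_of_mem v y _ h

theorem contract_node {J : Partition} (y : Dyadic → κ → ℂ) {A : Dyadic} (h : J.Above A)
    (hA : A ∉ J.parts) (a : κ) :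
    contract v J y A a =
      ∑ b, ∑ c, v b c a * (contract v J y A.left b * contract v J y A.right c) := by
  obtain ⟨hl, hr⟩ := h.halves hA
  rw [contract, contractAux_stable v y h J.depth (J.depth + 1) (by omega) (by omega)]
  simp only [contractAux, hA, if_false, contract]

theorem contractAux_update_of_not_subset {J : Partition} (y : Dyadic → κ → ℂ) {B : Dyadic}
    (u : κ → ℂ) (n : ℕ) {A : Dyadic} (h : ¬ B.toSet ⊆ A.toSet) :
    contractAux v J (Function.update y B u) n A = contractAux v J y n A := by
  have hne : A ≠ B := by rintro rfl; exact h subset_rfl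
  induction n generalizing A with
  | zero => simp [contractAux, Function.update_of_ne hne]
  | succ n ih =>
    have hl : ¬ B.toSet ⊆ A.left.toSet := fun h' => h (h'.trans A.left_subset)
    have hr : ¬ B.toSet ⊆ A.right.toSet := fun h' => h (h'.trans A.right_subset)
    simp only [contractAux, Function.update_of_ne hne]
    rw [ih hl (by rintro rfl; exact hl subset_rfl), ih hr (by rintro rfl; exact hr subset_rfl)]

theorem contractAux_update_linear {J : Partition} (y : Dyadic → κ → ℂ) {B : Dyadic}
    (hB : B ∈ J.parts) (n : ℕ) {A : Dyadic} (h : B.toSet ⊆ A.toSet) :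
    ∃ L : (κ → ℂ) →ₗ[ℂ] (κ → ℂ), ∀ u, contractAux v J (Function.update y B u) n A = L u := by
  by_cases hA : A ∈ J.parts
  · have : B = A := J.eq_of_subset hA hB h
    subst this
    exact ⟨LinearMap.id, fun u => by rw [contractAux_of_mem v _ n hA]; simp⟩
  induction n generalizing A with
  | zero => exact ⟨0, fun u => by simp [contractAux, hA]⟩
  | succ n ih =>
    have key : ∀ A' : Dyadic, B.toSet ⊆ A'.toSet → ∃ L : (κ → ℂ) →ₗ[ℂ] (κ → ℂ),
        ∀ u, contractAux v J (Function.update y B u) n A' = L u := by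
      intro A' h'
      by_cases hA' : A' ∈ J.parts
      · have : B = A' := J.eq_of_subset hA' hB h'
        subst this
        exact ⟨LinearMap.id, fun u => by rw [contractAux_of_mem v _ n hA']; simp⟩
      · exact ih h' hA'
    rcases Dyadic.subset_cases h (fun e => hA (e ▸ hB)) with ⟨h1, h2⟩ | ⟨h1, h2⟩
    · obtain ⟨L, hL⟩ := key _ h1
      refine ⟨LinearMap.pi fun a => ∑ b, ∑ c, (v b c a * contractAux v J y n A.right c) •
        (LinearMap.proj b ∘ₗ L), fun u => ?_⟩
      ext a
      simp only [contractAux, hA, if_false, hL, contractAux_update_of_not_subset v y u n h2,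
        LinearMap.pi_apply, LinearMap.sum_apply, LinearMap.smul_apply, LinearMap.comp_apply,
        LinearMap.proj_apply, smul_eq_mul]
      exact Finset.sum_congr rfl fun b _ => Finset.sum_congr rfl fun c _ => by ring
    · obtain ⟨L, hL⟩ := key _ h1
      refine ⟨LinearMap.pi fun a => ∑ b, ∑ c, (v b c a * contractAux v J y n A.left b) •
        (LinearMap.proj c ∘ₗ L), fun u => ?_⟩
      ext a
      simp only [contractAux, hA, if_false, hL, contractAux_update_of_not_subset v y u n h2,
        LinearMap.pi_apply, LinearMap.sum_apply, LinearMap.smul_apply, LinearMap.comp_apply,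
        LinearMap.proj_apply, smul_eq_mul]
      exact Finset.sum_congr rfl fun b _ => Finset.sum_congr rfl fun c _ => by ring

theorem prod_update_linear {I J : Partition} [DecidableEq J.parts] (hIJ : I ≤ J) (i : I.parts → κ)
    (y : J.parts → κ → ℂ) (B : J.parts) :
    ∃ L : (κ → ℂ) →ₗ[ℂ] ℂ, ∀ u,
      ∏ A : I.parts, contract v J (extend (Function.update y B u)) A (i A) = L u := by
  obtain ⟨A₀, hA₀, hsub⟩ := hIJ B B.2
  obtain ⟨L, hL⟩ := contractAux_update_linear v (extend y) B.2 J.depth hsub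
  refine ⟨(∏ A ∈ Finset.univ.erase (⟨A₀, hA₀⟩ : I.parts), contract v J (extend y) A (i A)) •
    (LinearMap.proj (i ⟨A₀, hA₀⟩) ∘ₗ L), fun u => ?_⟩
  rw [← Finset.mul_prod_erase Finset.univ _ (Finset.mem_univ (⟨A₀, hA₀⟩ : I.parts))]
  simp only [contract, extend_update, LinearMap.smul_apply, LinearMap.comp_apply,
    LinearMap.proj_apply, smul_eq_mul, hL]
  rw [mul_comm]
  congr 1
  refine Finset.prod_congr rfl fun A hA => ?_
  rw [contractAux_update_of_not_subset]
  intro hsub'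
  refine (Finset.mem_erase.1 hA).1 (Subtype.ext ?_)
  exact I.eq_of_mem A.2 hA₀ (hsub' (B : Dyadic).start_mem) (hsub (B : Dyadic).start_mem)

/-- The contraction of a forest as a multilinear function of the covectors at its leaves. -/
def forestForm {I J : Partition} (hIJ : I ≤ J) (i : I.parts → κ) :
    MultilinearMap ℂ (fun _ : J.parts => κ → ℂ) ℂ where
  toFun y := ∏ A : I.parts, contract v J (extend y) A (i A)
  map_update_add' y B u u' := by
    obtain ⟨L, hL⟩ := prod_update_linear v hIJ i y B
    simp only [hL, map_add]
  map_update_smul' y B c u := by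
    obtain ⟨L, hL⟩ := prod_update_linear v hIJ i y B
    simp only [hL, map_smul]

/-- The contraction is multiplicative in sums over the states at the leaves. -/
theorem sum_prod_contract {I J : Partition} (hIJ : I ≤ J) (i : I.parts → κ)
    {β : Type*} [Fintype β] (g : J.parts → β → κ → ℂ) :
    ∑ r : J.parts → β, ∏ A : I.parts, contract v J (extend fun B => g B (r B)) A (i A) =
      ∏ A : I.parts, contract v J (extend fun B => ∑ b, g B b) A (i A) := by
  classical
  exact ((forestForm v hIJ i).map_sum g).symm

theorem contract_trans {J K : Partition} (hJK : J ≤ K) (z : Dyadic → κ → ℂ) {A : Dyadic}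
    (hA : J.Above A) :
    contract v J (extend fun B : J.parts => contract v K z B) A = contract v K z A := by
  refine Partition.Above.induction (P := fun A =>
    contract v J (extend fun B : J.parts => contract v K z B) A = contract v K z A) ?_ ?_ hA
  · intro A hA
    rw [contract_leaf v _ hA]
    exact extend_of_mem _ (⟨A, hA⟩ : J.parts)
  · intro A hab hA hl hr
    have hAK : A ∉ K.parts := by
      intro hAK
      obtain ⟨B, hB, hAB⟩ := hJK A hAK
      have hBA := hab B hB _ (hAB A.start_mem) A.start_mem
      have := Dyadic.eq_of_level A.start_mem (hAB A.start_mem)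
        (le_antisymm (Dyadic.level_le_of_subset hBA) (Dyadic.level_le_of_subset hAB))
      exact hA (this ▸ hB)
    funext a
    rw [contract_node v _ hab hA, contract_node v _ (Partition.above_of_le hJK hab) hAK, hl, hr]

theorem contract_double {J : Partition} (y y' : J.parts → κ → ℂ) {A : Dyadic} (hA : J.Above A) :
    contract (κ := κ × κ) (fun b c a => star (v b.1 c.1 a.1) * v b.2 c.2 a.2) J
      (extend fun B p => star (y B p.1) * y' B p.2) A =
      fun p => star (contract v J (extend y) A p.1) * contract v J (extend y') A p.2 := by
  refine Partition.Above.induction (P := fun A =>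
    contract (κ := κ × κ) (fun b c a => star (v b.1 c.1 a.1) * v b.2 c.2 a.2) J
      (extend fun B p => star (y B p.1) * y' B p.2) A =
      fun p => star (contract v J (extend y) A p.1) * contract v J (extend y') A p.2) ?_ ?_ hA
  · intro A hA
    rw [contract_leaf _ _ hA, contract_leaf _ _ hA, contract_leaf _ _ hA]
    simp only [extend, hA, dif_pos]
  · intro A hab hA hl hr
    funext p
    rw [contract_node _ _ hab hA, contract_node _ _ hab hA, contract_node _ _ hab hA, hl, hr,
      star_sum, Finset.sum_mul_sum, Fintype.sum_prod_type]
    refine Finset.sum_congr rfl fun b _ => Finset.sum_congr rfl fun b' _ => ?_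
    rw [star_sum, Finset.sum_mul_sum, Fintype.sum_prod_type]
    refine Finset.sum_congr rfl fun c _ => Finset.sum_congr rfl fun c' _ => ?_
    simp only [star_mul']
    ring

variable [DecidableEq κ]

/-- The covectors at the leaves of `J` that pick out the basis configuration `j`. -/
def leafCovector {J : Partition} (j : J.parts → κ) : Dyadic → κ → ℂ :=
  extend fun B => Pi.single (j B) 1

/-- The matrix element between the basis configurations `i` of `I` and `j` of `J` of the tensor
network given by the forest with roots `I` and leaves `J`, with `v` at every inner node. -/
def forestAmplitude (I J : Partition) (i : I.parts → κ) (j : J.parts → κ) : ℂ :=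
  ∏ A : I.parts, contract v J (leafCovector j) A (i A)

theorem sum_forestAmplitude_mul {I J : Partition} (hIJ : I ≤ J) (i : I.parts → κ)
    (y : J.parts → κ → ℂ) :
    ∑ j : J.parts → κ, (∏ B, y B (j B)) * forestAmplitude v I J i j =
      ∏ A : I.parts, contract v J (extend y) A (i A) := by
  have h := sum_prod_contract v hIJ i (fun B b => y B b • (Pi.single b 1 : κ → ℂ))
  have e : (fun B => ∑ b, y B b • (Pi.single b 1 : κ → ℂ)) = y := by
    funext B
    exact (pi_eq_sum_univ' (y B)).symm
  rw [e] at h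
  rw [← h]
  refine Finset.sum_congr rfl fun j _ => ?_
  exact ((forestForm v hIJ i).map_smul_univ (fun B => y B (j B))
    (fun B => Pi.single (j B) 1)).symm

theorem forestAmplitude_trans {I J K : Partition} (hIJ : I ≤ J) (hJK : J ≤ K)
    (i : I.parts → κ) (k : K.parts → κ) :
    ∑ j, forestAmplitude v J K j k * forestAmplitude v I J i j = forestAmplitude v I K i k := by
  have h := sum_forestAmplitude_mul v hIJ i
    (fun B : J.parts => contract v K (leafCovector k) B)
  simp only [forestAmplitude] at h ⊢
  rw [h]
  refine Finset.prod_congr rfl fun A _ => ?_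
  rw [contract_trans v hJK _ (Partition.above_of_le hIJ (Partition.above_of_mem A.2))]

theorem forestAmplitude_self (I : Partition) (i j : I.parts → κ) :
    forestAmplitude v I I i j = if i = j then 1 else 0 := by
  have h : ∀ A : I.parts, contract v I (leafCovector j) A (i A) = if i A = j A then 1 else 0 := by
    intro A
    rw [contract_leaf v _ A.2, leafCovector, extend_of_mem, Pi.single_apply]
  simp only [forestAmplitude, h, Finset.prod_ite_zero, Finset.prod_const_one, funext_iff,
    Finset.mem_univ, true_imp_iff]

/-- If `v` is the tensor of an isometry then the columns of the forest network are orthonormal. -/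
theorem forestAmplitude_isometry
    (hv : ∀ a a', ∑ b, ∑ c, star (v b c a) * v b c a' = if a = a' then 1 else 0)
    {I J : Partition} (hIJ : I ≤ J) (i i' : I.parts → κ) :
    ∑ j, star (forestAmplitude v I J i j) * forestAmplitude v I J i' j =
      if i = i' then 1 else 0 := by
  have h := sum_prod_contract (κ := κ × κ)
    (fun b c a => star (v b.1 c.1 a.1) * v b.2 c.2 a.2) hIJ (fun A => (i A, i' A))
    (fun (_ : J.parts) (b : κ) (p : κ × κ) =>
      star ((Pi.single b 1 : κ → ℂ) p.1) * (Pi.single b 1 : κ → ℂ) p.2)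
  have hL : ∀ j : J.parts → κ,
      ∏ A : I.parts, contract (κ := κ × κ) (fun b c a => star (v b.1 c.1 a.1) * v b.2 c.2 a.2) J
        (extend fun B (p : κ × κ) =>
          star ((Pi.single (j B) 1 : κ → ℂ) p.1) * (Pi.single (j B) 1 : κ → ℂ) p.2) A
        (i A, i' A) = star (forestAmplitude v I J i j) * forestAmplitude v I J i' j := by
    intro j
    simp only [forestAmplitude, star_prod, ← Finset.prod_mul_distrib]
    refine Finset.prod_congr rfl fun A _ => ?_
    rw [contract_double v (fun B : J.parts => (Pi.single (j B) 1 : κ → ℂ))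
      (fun B : J.parts => (Pi.single (j B) 1 : κ → ℂ))
      (Partition.above_of_le hIJ (Partition.above_of_mem A.2))]
    rfl
  simp only [hL] at h
  rw [h]
  have hR : ∀ A : Dyadic, J.Above A →
      contract (κ := κ × κ) (fun b c a => star (v b.1 c.1 a.1) * v b.2 c.2 a.2) J
        (extend fun _ : J.parts => ∑ b, fun p : κ × κ =>
          star ((Pi.single b 1 : κ → ℂ) p.1) * (Pi.single b 1 : κ → ℂ) p.2) A =
        fun p => if p.1 = p.2 then 1 else 0 := by
    intro A hA
    refine Partition.Above.induction (P := fun A =>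
      contract (κ := κ × κ) (fun b c a => star (v b.1 c.1 a.1) * v b.2 c.2 a.2) J
        (extend fun _ : J.parts => ∑ b, fun p : κ × κ =>
          star ((Pi.single b 1 : κ → ℂ) p.1) * (Pi.single b 1 : κ → ℂ) p.2) A =
        fun p => if p.1 = p.2 then 1 else 0) ?_ ?_ hA
    · intro A hA
      rw [contract_leaf _ _ hA]
      funext p
      simp [extend, hA, Pi.single_apply, Finset.sum_apply]
    · intro A hab hA hl hr
      funext p
      rw [contract_node _ _ hab hA, hl, hr, ← hv, Fintype.sum_prod_type]
      simp [Fintype.sum_prod_type]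
  rw [Finset.prod_congr rfl fun A _ => by
    rw [hR A (Partition.above_of_le hIJ (Partition.above_of_mem A.2))]]
  simp only [Finset.prod_ite_zero, Finset.prod_const_one, funext_iff,
    Finset.mem_univ, true_imp_iff]

end Contract

/-! ### The semicontinuous limit -/

/-- The one-site space `ℂ ^ d`. -/
abbrev Qudit (d : ℕ) : Type := EuclideanSpace ℂ (Fin d)

/-- The space `(ℂ ^ d) ^ ⊗ |I|` with one tensor factor at each interval of `I`, written in its
product basis, which is indexed by the configurations `I → {0, …, d - 1}`. -/
abbrev LocalSpace (d : ℕ) (I : Partition) : Type := EuclideanSpace ℂ (I.parts → Fin d)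

section Limit

variable {d : ℕ} (V : Qudit d →ₗᵢ[ℂ] Qudit d ⊗[ℂ] Qudit d)

/-- The matrix element `⟨b ⊗ c, V a⟩` in the standard basis. -/
def isometryTensor (b c a : Fin d) : ℂ :=
  inner ℂ ((EuclideanSpace.single b (1 : ℂ) : Qudit d) ⊗ₜ[ℂ] EuclideanSpace.single c (1 : ℂ))
    (V (EuclideanSpace.single a 1))

theorem isometryTensor_isometry (a a' : Fin d) :
    ∑ b, ∑ c, star (isometryTensor V b c a) * isometryTensor V b c a' =
      if a = a' then 1 else 0 := by
  let e := (EuclideanSpace.basisFun (Fin d) ℂ)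
  have h := (e.tensorProduct e).sum_inner_mul_inner (V (e a)) (V (e a'))
  rw [V.inner_map_map, e.inner_eq_ite, Fintype.sum_prod_type] at h
  rw [← h]
  refine Finset.sum_congr rfl fun b _ => Finset.sum_congr rfl fun c _ => ?_
  simp only [isometryTensor, e, OrthonormalBasis.tensorProduct_apply, EuclideanSpace.basisFun_apply]
  congr 1
  exact inner_conj_symm (𝕜 := ℂ) (V (EuclideanSpace.single a 1)) _

/-- The refining map as a linear map. -/
def refineLin (I J : Partition) : LocalSpace d I →ₗ[ℂ] LocalSpace d J where
  toFun Ψ := WithLp.toLp 2 fun j => ∑ i, forestAmplitude (isometryTensor V) I J i j * Ψ i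
  map_add' Ψ Φ := by
    ext j
    simp [mul_add, Finset.sum_add_distrib]
  map_smul' c Ψ := by
    ext j
    simp only [PiLp.smul_apply, smul_eq_mul, RingHom.id_apply, Finset.mul_sum]
    exact Finset.sum_congr rfl fun i _ => by ring

theorem refineLin_apply (I J : Partition) (Ψ : LocalSpace d I) (j : J.parts → Fin d) :
    refineLin V I J Ψ j = ∑ i, forestAmplitude (isometryTensor V) I J i j * Ψ i := rfl

theorem refineLin_inner {I J : Partition} (h : I ≤ J) (Φ Ψ : LocalSpace d I) :
    inner ℂ (refineLin V I J Φ) (refineLin V I J Ψ) = inner ℂ Φ Ψ := by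
  simp only [PiLp.inner_apply, RCLike.inner_apply, refineLin_apply]
  calc _ = ∑ j, ∑ i, ∑ i', (star (forestAmplitude (isometryTensor V) I J i j) *
            forestAmplitude (isometryTensor V) I J i' j) * (star (Φ i) * Ψ i') := by
        refine Finset.sum_congr rfl fun j _ => ?_
        rw [map_sum, mul_comm, Finset.sum_mul_sum]
        refine Finset.sum_congr rfl fun i _ => Finset.sum_congr rfl fun i' _ => ?_
        simp only [map_mul, starRingEnd_apply]
        ring
    _ = ∑ i, ∑ i', (∑ j, star (forestAmplitude (isometryTensor V) I J i j) *
            forestAmplitude (isometryTensor V) I J i' j) * (star (Φ i) * Ψ i') := by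
        rw [Finset.sum_comm]
        refine Finset.sum_congr rfl fun i _ => ?_
        rw [Finset.sum_comm]
        exact Finset.sum_congr rfl fun i' _ => (Finset.sum_mul _ _ _).symm
    _ = _ := by
        simp only [forestAmplitude_isometry _ (isometryTensor_isometry V) h, ite_mul, one_mul,
          zero_mul, Finset.sum_ite_eq, Finset.mem_univ, if_true, starRingEnd_apply]
        exact Finset.sum_congr rfl fun i _ => mul_comm _ _

/-- The isometric refining map from `I` to a refinement `J`: the tensor network given by the
forest with roots `I` and leaves `J`, with `V` at every inner node. -/
def refine (I J : Partition) (h : I ≤ J) : LocalSpace d I →ₗᵢ[ℂ] LocalSpace d J :=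
  (refineLin V I J).isometryOfInner (refineLin_inner V h)

theorem refine_apply {I J : Partition} (h : I ≤ J) (Ψ : LocalSpace d I) (j : J.parts → Fin d) :
    refine V I J h Ψ j = ∑ i, forestAmplitude (isometryTensor V) I J i j * Ψ i := rfl

instance : DirectedSystem (LocalSpace d) (refine V · · ·) where
  map_self I Ψ := by
    ext j
    simp [refine_apply, forestAmplitude_self]
  map_map I J K hIJ hJK Ψ := by
    ext k
    simp only [refine_apply, Finset.mul_sum, ← forestAmplitude_trans (isometryTensor V) hIJ hJK,
      Finset.sum_mul]
    rw [Finset.sum_comm]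
    exact Finset.sum_congr rfl fun i _ => Finset.sum_congr rfl fun j _ => by ring

theorem refine_refine {I J K : Partition} (hIJ : I ≤ J) (hJK : J ≤ K) (Ψ : LocalSpace d I) :
    refine V J K hJK (refine V I J hIJ Ψ) = refine V I K (hIJ.trans hJK) Ψ :=
  DirectedSystem.map_map' (refine V) hIJ hJK Ψ

/-- The disjoint union of the spaces `LocalSpace d I` modulo the relation that identifies two
vectors which agree after passing to a common refinement. -/
def PreLimit : Type := DirectLimit (LocalSpace d) (refine V)

instance : AddCommGroup (PreLimit V) :=
  inferInstanceAs (AddCommGroup (DirectLimit (LocalSpace d) (refine V)))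

instance : Module ℂ (PreLimit V) :=
  inferInstanceAs (Module ℂ (DirectLimit (LocalSpace d) (refine V)))

/-- The equivalence class of a vector of `LocalSpace d I`. -/
def toPreLimit (I : Partition) : LocalSpace d I →ₗ[ℂ] PreLimit V where
  toFun Ψ := (⟦⟨I, Ψ⟩⟧ : DirectLimit (LocalSpace d) (refine V))
  map_add' Ψ Φ := (DirectLimit.add_def I Ψ Φ).symm
  map_smul' c Ψ := (DirectLimit.smul_def I Ψ c).symm

theorem toPreLimit_refine {I J : Partition} (h : I ≤ J) (Ψ : LocalSpace d I) :
    toPreLimit V J (refine V I J h Ψ) = toPreLimit V I Ψ :=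
  (DirectLimit.eq_of_le (f := refine V) ⟨I, Ψ⟩ J h).symm

theorem exists_eq_toPreLimit (x : PreLimit V) : ∃ I Ψ, x = toPreLimit V I Ψ :=
  DirectLimit.exists_eq_mk (refine V) x

theorem exists_eq_toPreLimit₂ (x y : PreLimit V) :
    ∃ I Ψ Φ, x = toPreLimit V I Ψ ∧ y = toPreLimit V I Φ :=
  DirectLimit.exists_eq_mk₂ (refine V) x y

theorem exists_eq_toPreLimit₃ (x y z : PreLimit V) :
    ∃ I Ψ Φ Θ, x = toPreLimit V I Ψ ∧ y = toPreLimit V I Φ ∧ z = toPreLimit V I Θ :=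
  DirectLimit.exists_eq_mk₃ (refine V) x y z

/-- The inner product of two classes, computed on representatives at a common refinement. -/
def preLimitInner (x y : PreLimit V) : ℂ :=
  DirectLimit.lift₂ (refine V) (refine V) (fun _ Φ Ψ => inner ℂ Φ Ψ)
    (fun I J h Φ Ψ => ((refine V I J h).inner_map_map Φ Ψ).symm) x y

theorem preLimitInner_toPreLimit (I : Partition) (Φ Ψ : LocalSpace d I) :
    preLimitInner V (toPreLimit V I Φ) (toPreLimit V I Ψ) = inner ℂ Φ Ψ :=
  DirectLimit.lift₂_def (refine V) (refine V) (fun _ Φ Ψ => inner ℂ Φ Ψ) _ I Φ Ψ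

/-- The inner product axioms on the classes. -/
@[reducible] def preLimitCore : InnerProductSpace.Core ℂ (PreLimit V) where
  inner := preLimitInner V
  conj_inner_symm x y := by
    obtain ⟨I, Ψ, Φ, rfl, rfl⟩ := exists_eq_toPreLimit₂ V x y
    rw [preLimitInner_toPreLimit, preLimitInner_toPreLimit, inner_conj_symm]
  re_inner_nonneg x := by
    obtain ⟨I, Ψ, rfl⟩ := exists_eq_toPreLimit V x
    rw [preLimitInner_toPreLimit]
    exact inner_self_nonneg
  add_left x y z := by
    obtain ⟨I, Ψ, Φ, Θ, rfl, rfl, rfl⟩ := exists_eq_toPreLimit₃ V x y z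
    rw [← map_add, preLimitInner_toPreLimit, preLimitInner_toPreLimit, preLimitInner_toPreLimit, inner_add_left]
  smul_left x y c := by
    obtain ⟨I, Ψ, Φ, rfl, rfl⟩ := exists_eq_toPreLimit₂ V x y
    rw [← map_smul, preLimitInner_toPreLimit, preLimitInner_toPreLimit, inner_smul_left]
  definite x h := by
    obtain ⟨I, Ψ, rfl⟩ := exists_eq_toPreLimit V x
    rw [preLimitInner_toPreLimit, inner_self_eq_zero] at h
    rw [h, map_zero]

instance : NormedAddCommGroup (PreLimit V) := (preLimitCore V).toNormedAddCommGroup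

instance : InnerProductSpace ℂ (PreLimit V) := InnerProductSpace.ofCore (preLimitCore V).toCore

theorem inner_toPreLimit (I : Partition) (Φ Ψ : LocalSpace d I) :
    inner ℂ (toPreLimit V I Φ) (toPreLimit V I Ψ) = inner ℂ Φ Ψ :=
  preLimitInner_toPreLimit V I Φ Ψ

/-- The semicontinuous limit: the Hilbert space completion of `PreLimit V`. -/
abbrev Limit : Type := UniformSpace.Completion (PreLimit V)

/-- The element of the semicontinuous limit represented by a vector of `LocalSpace d I`. -/
def toLimit (I : Partition) (Ψ : LocalSpace d I) : Limit V := (toPreLimit V I Ψ : PreLimit V)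

theorem inner_toLimit (I : Partition) (Φ Ψ : LocalSpace d I) :
    inner ℂ (toLimit V I Φ) (toLimit V I Ψ) = inner ℂ Φ Ψ := by
  rw [toLimit, toLimit, UniformSpace.Completion.inner_coe]
  exact inner_toPreLimit V I Φ Ψ

end Limit

/-! ### Thompson's group -/

/-- The homeomorphism `f` of the circle `ℝ / ℤ` maps the dyadic interval `A` onto the dyadic
interval `B` by the increasing affine bijection. -/
def MapsAffinely (f : UnitAddCircle ≃ₜ UnitAddCircle) (A B : Dyadic) : Prop :=
  ∀ t ∈ Set.Icc (0 : ℝ) 1, f (((A.index + t) / 2 ^ A.level : ℝ) : UnitAddCircle) =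
    (((B.index + t) / 2 ^ B.level : ℝ) : UnitAddCircle)

theorem coe_inj_of_mem {x y : ℝ} (hx : x ∈ Set.Ico (0 : ℝ) 1) (hy : y ∈ Set.Ico (0 : ℝ) 1)
    (h : (x : UnitAddCircle) = y) : x = y := by
  have hx' : x ∈ Set.Ico (0 : ℝ) (0 + 1) := by simpa using hx
  have hy' : y ∈ Set.Ico (0 : ℝ) (0 + 1) := by simpa using hy
  exact (AddCircle.coe_eq_coe_iff_of_mem_Ico hx' hy').1 h

theorem exists_rep (z : UnitAddCircle) : ∃ x ∈ Set.Ico (0 : ℝ) 1, (x : UnitAddCircle) = z := by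
  have h := (AddCircle.coe_image_Ico_eq (p := (1 : ℝ)) 0).symm ▸ Set.mem_univ z
  simpa using h

theorem Dyadic.mem_iff_exists (A : Dyadic) (x : ℝ) :
    x ∈ A.toSet ↔ ∃ t ∈ Set.Ico (0 : ℝ) 1, x = (A.index + t) / 2 ^ A.level := by
  have h : (0 : ℝ) < 2 ^ A.level := by positivity
  rw [A.mem_iff]
  constructor
  · rintro ⟨h1, h2⟩
    refine ⟨x * 2 ^ A.level - A.index, ⟨by linarith, by linarith⟩, ?_⟩
    field_simp
    ring
  · rintro ⟨t, ⟨h1, h2⟩, rfl⟩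
    rw [div_mul_cancel₀ _ h.ne']
    constructor <;> linarith

namespace MapsAffinely

variable {f g : UnitAddCircle ≃ₜ UnitAddCircle} {A B C : Dyadic}

theorem symm (h : MapsAffinely f A B) : MapsAffinely f⁻¹ B A := by
  intro t ht
  rw [← h t ht]
  exact f.symm_apply_apply _

theorem comp (hf : MapsAffinely f B C) (hg : MapsAffinely g A B) :
    MapsAffinely (f * g) A C := by
  intro t ht
  rw [Homeomorph.mul_apply, hg t ht, hf t ht]

theorem one (A : Dyadic) : MapsAffinely 1 A A := fun _ _ => rfl

theorem exists_image (h : MapsAffinely f A B) {x : ℝ} (hx : x ∈ A.toSet) :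
    ∃ y ∈ B.toSet, f (x : UnitAddCircle) = (y : UnitAddCircle) := by
  obtain ⟨t, ht, rfl⟩ := (A.mem_iff_exists x).1 hx
  exact ⟨_, (B.mem_iff_exists _).2 ⟨t, ht, rfl⟩, h t (Set.Ico_subset_Icc_self ht)⟩

theorem exists_preimage (h : MapsAffinely f A B) {y : ℝ} (hy : y ∈ B.toSet) :
    ∃ x ∈ A.toSet, f (x : UnitAddCircle) = (y : UnitAddCircle) := by
  obtain ⟨t, ht, rfl⟩ := (B.mem_iff_exists y).1 hy
  exact ⟨_, (A.mem_iff_exists _).2 ⟨t, ht, rfl⟩, h t (Set.Ico_subset_Icc_self ht)⟩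

theorem mem_of_mem (h : MapsAffinely f A B) {x y : ℝ} (hx : x ∈ A.toSet)
    (hy : y ∈ Set.Ico (0 : ℝ) 1) (hxy : f (x : UnitAddCircle) = (y : UnitAddCircle)) :
    y ∈ B.toSet := by
  obtain ⟨y', hy', e⟩ := h.exists_image hx
  rw [coe_inj_of_mem hy (B.sub_unit hy') (hxy.symm.trans e)]
  exact hy'

theorem mem_of_mem' (h : MapsAffinely f A B) {x y : ℝ} (hx : x ∈ Set.Ico (0 : ℝ) 1)
    (hy : y ∈ B.toSet) (hxy : f (x : UnitAddCircle) = (y : UnitAddCircle)) : x ∈ A.toSet := by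
  obtain ⟨x', hx', e⟩ := h.exists_preimage hy
  rw [coe_inj_of_mem hx (A.sub_unit hx') (f.injective (hxy.trans e.symm))]
  exact hx'

theorem right_unique (h : MapsAffinely f A B) (h' : MapsAffinely f A C) : B = C := by
  have key : ∀ t ∈ Set.Ico (0 : ℝ) 1,
      (B.index + t) / 2 ^ B.level = (C.index + t) / 2 ^ C.level := by
    intro t ht
    refine coe_inj_of_mem (B.sub_unit ((B.mem_iff_exists _).2 ⟨t, ht, rfl⟩))
      (C.sub_unit ((C.mem_iff_exists _).2 ⟨t, ht, rfl⟩)) ?_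
    rw [← h t (Set.Ico_subset_Icc_self ht), h' t (Set.Ico_subset_Icc_self ht)]
  have h0 := key 0 (by norm_num)
  have h1 := key (1 / 2) (by norm_num)
  rw [add_zero, add_zero] at h0
  rw [add_div, add_div, h0, add_right_inj] at h1
  have h2 : (2 : ℝ) ^ B.level = 2 ^ C.level := by
    field_simp at h1
    exact h1.symm
  have h3 : B.level = C.level := pow_right_injective₀ (by norm_num) (by norm_num) h2
  exact Dyadic.eq_of_level B.start_mem (by rw [h0]; exact C.start_mem) h3

theorem left_unique (h : MapsAffinely f A C) (h' : MapsAffinely f B C) : A = B :=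
  h.symm.right_unique h'.symm

theorem left (h : MapsAffinely f A B) : MapsAffinely f A.left B.left := by
  intro t ht
  have e : ∀ D : Dyadic, ((D.left.index : ℝ) + t) / 2 ^ D.left.level =
      (D.index + t / 2) / 2 ^ D.level := by
    intro D
    simp only [Dyadic.left]
    push_cast
    field_simp
    ring
  rw [e, e]
  exact h _ ⟨by linarith [ht.1], by linarith [ht.2]⟩

theorem right (h : MapsAffinely f A B) : MapsAffinely f A.right B.right := by
  intro t ht
  have e : ∀ D : Dyadic, ((D.right.index : ℝ) + t) / 2 ^ D.right.level =
      (D.index + (1 + t) / 2) / 2 ^ D.level := by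
    intro D
    simp only [Dyadic.right]
    push_cast
    field_simp
    ring
  rw [e, e]
  exact h _ ⟨by linarith [ht.1], by linarith [ht.2]⟩

theorem exists_of_subset (h : MapsAffinely f A B) {A' : Dyadic} (hA : A'.toSet ⊆ A.toSet) :
    ∃ B', MapsAffinely f A' B' := by
  obtain ⟨k, hk⟩ := Nat.exists_eq_add_of_le (Dyadic.level_le_of_subset hA)
  induction k generalizing A B with
  | zero =>
    have := Dyadic.eq_of_level A'.start_mem (hA A'.start_mem) (by omega)
    exact ⟨B, this ▸ h⟩
  | succ k ih =>
    rcases Dyadic.subset_cases hA (fun e => by rw [e] at hk; omega) with h1 | h1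
    · exact ih h.left h1.1 (by simp only [Dyadic.left]; omega)
    · exact ih h.right h1.1 (by simp only [Dyadic.right]; omega)

end MapsAffinely

/-- The partition `J` is the image of the partition `I` under `f`, and `f` is affine on every
interval of `I`. -/
def Carries (f : UnitAddCircle ≃ₜ UnitAddCircle) (I J : Partition) : Prop :=
  ∀ A ∈ I.parts, ∃ B ∈ J.parts, MapsAffinely f A B

namespace Carries

variable {f g : UnitAddCircle ≃ₜ UnitAddCircle} {I I' J J' K : Partition}

theorem one (I : Partition) : Carries 1 I I := fun A hA => ⟨A, hA, MapsAffinely.one A⟩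

theorem comp (hf : Carries f J K) (hg : Carries g I J) : Carries (f * g) I K := by
  intro A hA
  obtain ⟨B, hB, h⟩ := hg A hA
  obtain ⟨C, hC, h'⟩ := hf B hB
  exact ⟨C, hC, h'.comp h⟩

theorem symm (h : Carries f I J) : Carries f⁻¹ J I := by
  intro B hB
  obtain ⟨x, hx, e⟩ := exists_rep (f.symm ((B.index / 2 ^ B.level : ℝ) : UnitAddCircle))
  have e' : f (x : UnitAddCircle) = ((B.index / 2 ^ B.level : ℝ) : UnitAddCircle) := by
    rw [e, f.apply_symm_apply]
  obtain ⟨A, ⟨hA, hxA⟩, -⟩ := I.existsUnique_mem x hx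
  obtain ⟨B', hB', hAB⟩ := h A hA
  have := J.eq_of_mem hB' hB (hAB.mem_of_mem hxA (B.sub_unit B.start_mem) e') B.start_mem
  exact ⟨A, hA, (this ▸ hAB).symm⟩

theorem mem_iff (h : Carries f I J) {A B : Dyadic} (hAB : MapsAffinely f A B) :
    A ∈ I.parts ↔ B ∈ J.parts := by
  constructor
  · intro hA
    obtain ⟨B', hB', h'⟩ := h A hA
    exact (h'.right_unique hAB) ▸ hB'
  · intro hB
    obtain ⟨A', hA', h'⟩ := h.symm B hB
    exact (h'.right_unique hAB.symm) ▸ hA'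

theorem mono (h : Carries f I J) (h' : Carries f I' J') (hI : I ≤ I') : J ≤ J' := by
  intro B' hB'
  obtain ⟨A', hA', hBA⟩ := h'.symm B' hB'
  obtain ⟨A, hA, hsub⟩ := hI A' hA'
  obtain ⟨B, hB, hAB⟩ := h A hA
  refine ⟨B, hB, fun y hy => ?_⟩
  obtain ⟨x, hx, e⟩ := hBA.exists_image hy
  refine hAB.mem_of_mem (hsub hx) (B'.sub_unit hy) ?_
  rw [← e]
  exact f.apply_symm_apply _

/-- If `f` maps every interval of `I` affinely onto a dyadic interval, then the images form a
partition. -/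
theorem exists_image (h : ∀ A ∈ I.parts, ∃ B, MapsAffinely f A B) : ∃ J, Carries f I J := by
  choose φ hφ using h
  refine ⟨⟨I.parts.attach.image fun A : I.parts => φ A.1 A.2, fun y hy => ?_⟩, fun A hA => ⟨φ A hA, ?_, hφ A hA⟩⟩
  · obtain ⟨x, hx, e⟩ := exists_rep (f.symm (y : UnitAddCircle))
    have e' : f (x : UnitAddCircle) = (y : UnitAddCircle) := by rw [e, f.apply_symm_apply]
    obtain ⟨A, ⟨hA, hxA⟩, huniq⟩ := I.existsUnique_mem x hx
    refine ⟨φ A hA, ⟨Finset.mem_image.2 ⟨⟨A, hA⟩, Finset.mem_attach _ _, rfl⟩,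
      (hφ A hA).mem_of_mem hxA hy e'⟩, ?_⟩
    rintro B ⟨hB, hyB⟩
    obtain ⟨⟨A', hA'⟩, -, rfl⟩ := Finset.mem_image.1 hB
    have : A' = A := huniq A' ⟨hA', (hφ A' hA').mem_of_mem' hx hyB e'⟩
    subst this
    rfl
  · exact Finset.mem_image.2 ⟨⟨A, hA⟩, Finset.mem_attach _ _, rfl⟩

theorem exists_refine (h : Carries f I J) (hI : I ≤ I') : ∃ J', Carries f I' J' := by
  refine exists_image fun A' hA' => ?_
  obtain ⟨A, hA, hsub⟩ := hI A' hA'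
  obtain ⟨B, -, hAB⟩ := h A hA
  exact hAB.exists_of_subset hsub

end Carries

/-- `f` is piecewise linear, with slopes integer powers of two (in particular orientation
preserving), with breakpoints dyadic rationals, and maps dyadic rationals to dyadic rationals:
for some `N` (such that all breakpoints are multiples of `2 ^ (-N)`) it has the form
`x ↦ 2 ^ k * x + r / 2 ^ s` on each of the intervals `[p / 2 ^ N, (p + 1) / 2 ^ N]`. -/
def IsThompson (f : UnitAddCircle ≃ₜ UnitAddCircle) : Prop :=
  ∃ N : ℕ, ∀ p : ℕ, p < 2 ^ N → ∃ (k r : ℤ) (s : ℕ),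
    ∀ x ∈ Set.Icc ((p : ℝ) / 2 ^ N) ((p + 1 : ℝ) / 2 ^ N),
      f (x : UnitAddCircle) = (((2 : ℝ) ^ k * x + r / 2 ^ s : ℝ) : UnitAddCircle)

theorem Carries.isThompson {f : UnitAddCircle ≃ₜ UnitAddCircle} {I J : Partition}
    (h : Carries f I J) : IsThompson f := by
  refine ⟨I.depth, fun p hp => ?_⟩
  obtain ⟨J', h'⟩ := h.exists_refine (I.le_uniform le_rfl)
  obtain ⟨B, -, hB⟩ := h' ⟨I.depth, p, hp⟩ (Partition.mem_uniform.2 rfl)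
  refine ⟨(I.depth : ℤ) - B.level, (B.index : ℤ) - p, B.level, fun x hx => ?_⟩
  have h2 : (0 : ℝ) < 2 ^ I.depth := by positivity
  obtain ⟨hx1, hx2⟩ := hx
  rw [div_le_iff₀ h2] at hx1
  rw [le_div_iff₀ h2] at hx2
  have := hB (x * 2 ^ I.depth - p) ⟨by linarith, by linarith⟩
  simp only at this
  have e1 : ((p : ℝ) + (x * 2 ^ I.depth - p)) / 2 ^ I.depth = x := by
    field_simp
    ring
  rw [e1] at this
  rw [this]
  congr 1
  rw [zpow_sub₀ (by norm_num), zpow_natCast, zpow_natCast]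
  push_cast
  field_simp
  ring

theorem IsThompson.exists_carries {f : UnitAddCircle ≃ₜ UnitAddCircle} (h : IsThompson f) :
    ∃ I J, Carries f I J := by
  obtain ⟨N, h⟩ := h
  choose k r s h using fun p : Fin (2 ^ N) => h p p.2
  let M := N + ∑ p, ((k p).natAbs + s p)
  refine ⟨Partition.uniform M, Carries.exists_image fun A hA => ?_⟩
  have hAM := Partition.mem_uniform.1 hA
  obtain ⟨D, ⟨hD, hxD⟩, -⟩ :=
    (Partition.uniform N).existsUnique_mem _ (A.sub_unit A.start_mem)
  have hDN := Partition.mem_uniform.1 hD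
  have hNM : N ≤ M := Nat.le_add_right _ _
  have hsub : A.toSet ⊆ D.toSet := Dyadic.nested hxD A.start_mem (by omega)
  let p : Fin (2 ^ N) := ⟨D.index, hDN ▸ D.index_lt⟩
  have hp : (k p).natAbs + s p ≤ ∑ p, ((k p).natAbs + s p) :=
    Finset.single_le_sum (f := fun p => (k p).natAbs + s p) (fun _ _ => Nat.zero_le _)
      (Finset.mem_univ p)
  obtain ⟨m, hm⟩ : ∃ m : ℕ, (m : ℤ) = M - k p := ⟨((M : ℤ) - k p).toNat, by omega⟩
  obtain ⟨u, hu⟩ : ∃ u : ℕ, m = s p + u := Nat.exists_eq_add_of_le (by omega)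
  let q : ℤ := A.index + r p * 2 ^ u
  have hmod0 : 0 ≤ q % 2 ^ m := Int.emod_nonneg _ (by positivity)
  have hmod1 : q % 2 ^ m < 2 ^ m := Int.emod_lt_of_pos _ (by positivity)
  refine ⟨⟨m, (q % 2 ^ m).toNat, by zify; rw [Int.toNat_of_nonneg hmod0]; exact hmod1⟩, ?_⟩
  intro t ht
  have hIcc : ((A.index : ℝ) + t) / 2 ^ A.level ∈
      Set.Icc ((p : ℕ) / 2 ^ N : ℝ) (((p : ℕ) + 1 : ℝ) / 2 ^ N) := by
    have hlt : (A.index : ℝ) / 2 ^ A.level < (A.index + 1) / 2 ^ A.level := by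
      gcongr; linarith
    have h1 := (Set.Ico_subset_Ico_iff hlt).1 hsub
    rw [hDN] at h1
    refine ⟨h1.1.trans ?_, le_trans ?_ h1.2⟩
    · gcongr; linarith [ht.1]
    · gcongr; exact ht.2
  rw [h p _ hIcc]
  have hq : (((q % 2 ^ m).toNat : ℕ) : ℝ) = (q : ℝ) - 2 ^ m * ((q / 2 ^ m : ℤ) : ℝ) := by
    have e := Int.emod_add_mul_ediv q (2 ^ m)
    have e2 : (((q % 2 ^ m).toNat : ℕ) : ℤ) = q - 2 ^ m * (q / 2 ^ m) := by
      rw [Int.toNat_of_nonneg hmod0]; linarith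
    exact_mod_cast e2
  simp only
  rw [hq]
  have e3 : ((q : ℝ) - 2 ^ m * ((q / 2 ^ m : ℤ) : ℝ) + t) / 2 ^ m =
      ((2 : ℝ) ^ k p * ((A.index + t) / 2 ^ A.level) + r p / 2 ^ s p) - ((q / 2 ^ m : ℤ) : ℝ) := by
    have hk : k p = (M : ℤ) - m := by omega
    have hq' : (q : ℝ) = A.index + r p * 2 ^ u := by simp [q]
    rw [hq', hk, hAM, zpow_sub₀ (by norm_num), zpow_natCast, zpow_natCast, hu, pow_add]
    field_simp
    ring
  rw [e3]
  rw [AddCircle.coe_sub, eq_comm, sub_eq_self]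
  exact (AddCircle.coe_eq_zero_iff (1 : ℝ)).2 ⟨q / 2 ^ m, by simp⟩

/-- Thompson's group `T`, as a group of homeomorphisms of the circle `ℝ / ℤ`. -/
def thompsonT : Subgroup (UnitAddCircle ≃ₜ UnitAddCircle) where
  carrier := {f | IsThompson f}
  one_mem' := (Carries.one (Partition.uniform 0)).isThompson
  mul_mem' {f g} hf hg := by
    obtain ⟨I, J, hf⟩ := IsThompson.exists_carries hf
    obtain ⟨K, L, hg⟩ := IsThompson.exists_carries hg
    obtain ⟨M, hIM, hLM⟩ := exists_ge_ge I L
    obtain ⟨J', hf'⟩ := hf.exists_refine hIM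
    obtain ⟨K', hg'⟩ := hg.symm.exists_refine hLM
    have := hg'.symm
    rw [inv_inv] at this
    exact (hf'.comp this).isThompson
  inv_mem' {f} hf := by
    obtain ⟨I, J, hf⟩ := IsThompson.exists_carries hf
    exact hf.symm.isThompson

theorem thompsonT.exists_carries (f : thompsonT) (I : Partition) :
    ∃ I' J', I ≤ I' ∧ Carries f I' J' := by
  obtain ⟨K, L, h⟩ := IsThompson.exists_carries f.2
  obtain ⟨M, hIM, hKM⟩ := exists_ge_ge I K
  obtain ⟨J', h'⟩ := h.exists_refine hKM
  exact ⟨M, J', hIM, h'⟩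

/-- The translation `x ↦ x + 2 ^ (-k)` of the circle, as an element of Thompson's group. -/
def translation (k : ℕ) : thompsonT :=
  ⟨Homeomorph.addRight (((1 : ℝ) / 2 ^ k : ℝ) : UnitAddCircle), 0, fun p _ => ⟨0, 1, k, fun x _ => by
    simp⟩⟩

/-! ### The representation of Thompson's group -/

namespace Carries

variable {f g : UnitAddCircle ≃ₜ UnitAddCircle} {I I' J J' K : Partition}

/-- The interval of `J` that is the image under `f` of a given interval of `I`. -/
def image (h : Carries f I J) (A : I.parts) : J.parts :=
  ⟨(h A A.2).choose, (h A A.2).choose_spec.1⟩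

theorem image_spec (h : Carries f I J) (A : I.parts) : MapsAffinely f A (h.image A) :=
  (h A A.2).choose_spec.2

theorem image_eq (h : Carries f I J) {A : I.parts} {B : J.parts} (hAB : MapsAffinely f A B) :
    h.image A = B :=
  Subtype.ext ((h.image_spec A).right_unique hAB)

/-- `f` induces a bijection between the intervals of `I` and those of `J`. -/
def imageEquiv (h : Carries f I J) : I.parts ≃ J.parts where
  toFun := h.image
  invFun := h.symm.image
  left_inv A := h.symm.image_eq (h.image_spec A).symm
  right_inv B := h.image_eq (by simpa using (h.symm.image_spec B).symm)

theorem above (h : Carries f I J) {A B : Dyadic} (hAB : MapsAffinely f A B) (hA : I.Above A) :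
    J.Above B := by
  intro B' hB' y hyB' hyB
  obtain ⟨A', hA', hBA⟩ := h.symm B' hB'
  have hAB' : MapsAffinely f A' B' := by simpa using hBA.symm
  obtain ⟨x, hx, e⟩ := hAB'.exists_preimage hyB'
  have hsub := hA A' hA' x hx (hAB.mem_of_mem' (A'.sub_unit hx) hyB e)
  intro z hz
  obtain ⟨w, hw, e⟩ := hAB'.exists_preimage hz
  exact hAB.mem_of_mem (hsub hw) (B'.sub_unit hz) e

theorem contract_eq {κ : Type*} [Fintype κ] (v : κ → κ → κ → ℂ) (h : Carries f I J)
    {y y' : Dyadic → κ → ℂ}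
    (hy : ∀ A ∈ I.parts, ∀ B, MapsAffinely f A B → y' B = y A) {A B : Dyadic}
    (hA : I.Above A) (hAB : MapsAffinely f A B) : contract v J y' B = contract v I y A := by
  revert B
  refine Partition.Above.induction (P := fun A => ∀ {B}, MapsAffinely f A B →
    contract v J y' B = contract v I y A) ?_ ?_ hA
  · intro A hA B hAB
    rw [contract_leaf v _ hA, contract_leaf v _ ((h.mem_iff hAB).1 hA), hy A hA B hAB]
  · intro A hab hA hl hr B hAB
    have hB : B ∉ J.parts := fun hB => hA ((h.mem_iff hAB).2 hB)
    funext a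
    rw [contract_node v _ hab hA, contract_node v _ (h.above hAB hab) hB, hl hAB.left,
      hr hAB.right]

theorem forestAmplitude_eq {κ : Type*} [Fintype κ] [DecidableEq κ] (v : κ → κ → κ → ℂ)
    (h : Carries f I J) (h' : Carries f I' J') (hI : I ≤ I') (i : J.parts → κ)
    (j : J'.parts → κ) :
    forestAmplitude v J J' i j = forestAmplitude v I I' (i ∘ h.image) (j ∘ h'.image) := by
  symm
  refine Fintype.prod_equiv h.imageEquiv _ _ fun A => ?_
  have := h'.contract_eq v (y := leafCovector (j ∘ h'.image)) (y' := leafCovector j) ?_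
    (Partition.above_of_le hI (Partition.above_of_mem A.2)) (h.image_spec A)
  · exact (congrFun this (i (h.image A))).symm
  · intro A hA B hAB
    have hB : B ∈ J'.parts := (h'.mem_iff hAB).1 hA
    have e : h'.image ⟨A, hA⟩ = ⟨B, hB⟩ := h'.image_eq hAB
    simp only [leafCovector, extend, hA, hB, dif_pos, Function.comp_apply, e]

variable {d : ℕ}

/-- The relabelling of the tensor factors: the factor at the interval `A` of `I` becomes the
factor at the interval `f A` of `J`. -/
def relabel (h : Carries f I J) : LocalSpace d I →ₗ[ℂ] LocalSpace d J where
  toFun Ψ := WithLp.toLp 2 fun j => Ψ (j ∘ h.image)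
  map_add' _ _ := rfl
  map_smul' _ _ := rfl

theorem relabel_apply (h : Carries f I J) (Ψ : LocalSpace d I) (j : J.parts → Fin d) :
    h.relabel Ψ j = Ψ (j ∘ h.image) := rfl

theorem relabel_inner (h : Carries f I J) (Φ Ψ : LocalSpace d I) :
    inner ℂ (h.relabel Φ) (h.relabel Ψ) = inner ℂ Φ Ψ := by
  simp only [PiLp.inner_apply, relabel_apply]
  exact Fintype.sum_equiv (h.imageEquiv.symm.arrowCongr (Equiv.refl (Fin d))) _ _ fun j => rfl

theorem relabel_one (h : Carries 1 I I) (Ψ : LocalSpace d I) : h.relabel Ψ = Ψ := by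
  have : h.image = id := funext fun A => h.image_eq (MapsAffinely.one _)
  ext j
  rw [relabel_apply, this, Function.comp_id]

theorem relabel_comp (hf : Carries f J K) (hg : Carries g I J) (hfg : Carries (f * g) I K)
    (Ψ : LocalSpace d I) : hfg.relabel Ψ = hf.relabel (hg.relabel Ψ) := by
  have : hfg.image = hf.image ∘ hg.image :=
    funext fun A => hfg.image_eq ((hf.image_spec _).comp (hg.image_spec _))
  ext j
  rw [relabel_apply, relabel_apply, relabel_apply, this, Function.comp_assoc]

theorem relabel_refine (V : Qudit d →ₗᵢ[ℂ] Qudit d ⊗[ℂ] Qudit d)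
    (h : Carries f I J) (h' : Carries f I' J') (hI : I ≤ I') (Ψ : LocalSpace d I) :
    h'.relabel (refine V I I' hI Ψ) = refine V J J' (h.mono h' hI) (h.relabel Ψ) := by
  ext j
  rw [relabel_apply, refine_apply, refine_apply]
  refine (Fintype.sum_equiv (h.imageEquiv.symm.arrowCongr (Equiv.refl (Fin d))) _ _
    fun i => ?_).symm
  rw [h.forestAmplitude_eq (isometryTensor V) h' hI, relabel_apply]
  rfl

end Carries

section Representation

variable {d : ℕ} (V : Qudit d →ₗᵢ[ℂ] Qudit d ⊗[ℂ] Qudit d)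

/-- The vector obtained by refining `I` to `I'`, applying `f` and passing to the limit does not
depend on the choice of the refinement. -/
theorem relabel_wellDefined {f : UnitAddCircle ≃ₜ UnitAddCircle} {I I₁ I₂ J₁ J₂ : Partition}
    (h₁ : Carries f I₁ J₁) (h₂ : Carries f I₂ J₂) (hI₁ : I ≤ I₁) (hI₂ : I ≤ I₂)
    (Ψ : LocalSpace d I) :
    toPreLimit V J₁ (h₁.relabel (refine V I I₁ hI₁ Ψ)) =
      toPreLimit V J₂ (h₂.relabel (refine V I I₂ hI₂ Ψ)) := by
  obtain ⟨M, hM₁, hM₂⟩ := exists_ge_ge I₁ I₂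
  obtain ⟨L, hL⟩ := h₁.exists_refine hM₁
  rw [← toPreLimit_refine V (h₁.mono hL hM₁), ← toPreLimit_refine V (h₂.mono hL hM₂),
    ← h₁.relabel_refine V hL hM₁, ← h₂.relabel_refine V hL hM₂, refine_refine, refine_refine]

/-- A refinement of `I` whose image under `f` is again a standard dyadic partition. -/
def goodRefinement (f : thompsonT) (I : Partition) : Partition :=
  (thompsonT.exists_carries f I).choose

/-- The image of `goodRefinement f I` under `f`. -/
def goodImage (f : thompsonT) (I : Partition) : Partition :=
  (thompsonT.exists_carries f I).choose_spec.choose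

theorem le_goodRefinement (f : thompsonT) (I : Partition) : I ≤ goodRefinement f I :=
  (thompsonT.exists_carries f I).choose_spec.choose_spec.1

theorem carries_good (f : thompsonT) (I : Partition) :
    Carries (f : UnitAddCircle ≃ₜ UnitAddCircle) (goodRefinement f I) (goodImage f I) :=
  (thompsonT.exists_carries f I).choose_spec.choose_spec.2

/-- The action of `f` on classes: refine `I` until its image under `f` is a standard dyadic
partition, and relabel the tensor factors according to `f`. -/
def actFun (f : thompsonT) : PreLimit V → PreLimit V :=
  DirectLimit.lift (refine V)
    (fun I Ψ => toPreLimit V (goodImage f I)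
      ((carries_good f I).relabel (refine V I (goodRefinement f I) (le_goodRefinement f I) Ψ)))
    (fun I J h Ψ => by
      rw [refine_refine V h (le_goodRefinement f J) Ψ]
      exact relabel_wellDefined V _ _ _ _ Ψ)

theorem actFun_toPreLimit {f : thompsonT} {I J : Partition}
    (h : Carries (f : UnitAddCircle ≃ₜ UnitAddCircle) I J) (Ψ : LocalSpace d I) :
    actFun V f (toPreLimit V I Ψ) = toPreLimit V J (h.relabel Ψ) := by
  have := relabel_wellDefined V (carries_good f I) h (le_goodRefinement f I) le_rfl Ψ
  rw [show refine V I I le_rfl Ψ = Ψ from DirectedSystem.map_self' (refine V) Ψ] at this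
  exact this

/-- A class has a representative on a partition whose image under `f` is a standard dyadic
partition. -/
theorem exists_good (f : thompsonT) (x : PreLimit V) :
    ∃ (I J : Partition) (_ : Carries (f : UnitAddCircle ≃ₜ UnitAddCircle) I J)
      (Ψ : LocalSpace d I), x = toPreLimit V I Ψ := by
  obtain ⟨I, Ψ, rfl⟩ := exists_eq_toPreLimit V x
  exact ⟨_, _, carries_good f I, refine V I _ (le_goodRefinement f I) Ψ,
    (toPreLimit_refine V _ Ψ).symm⟩

theorem actFun_one (x : PreLimit V) : actFun V 1 x = x := by
  obtain ⟨I, Ψ, rfl⟩ := exists_eq_toPreLimit V x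
  rw [actFun_toPreLimit V (f := 1) (Carries.one I), Carries.relabel_one]

theorem actFun_mul (f g : thompsonT) (x : PreLimit V) :
    actFun V (f * g) x = actFun V f (actFun V g x) := by
  obtain ⟨I, J, hg, Ψ, rfl⟩ := exists_good V g x
  have hf := carries_good f J
  obtain ⟨I', hI'⟩ := hg.symm.exists_refine (le_goodRefinement f J)
  have hle : I ≤ I' := hg.symm.mono hI' (le_goodRefinement f J)
  have hg' := hI'.symm
  rw [inv_inv] at hg'
  have hfg : Carries ((f * g : thompsonT) : UnitAddCircle ≃ₜ UnitAddCircle) I' (goodImage f J) :=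
    hf.comp hg'
  rw [← toPreLimit_refine V hle, actFun_toPreLimit V hfg, actFun_toPreLimit V hg',
    actFun_toPreLimit V hf]
  congr 1
  exact Carries.relabel_comp hf hg' hfg _

/-- The action of `f` on classes is linear. -/
def actLin (f : thompsonT) : PreLimit V →ₗ[ℂ] PreLimit V where
  toFun := actFun V f
  map_add' x y := by
    obtain ⟨I, Ψ, Φ, rfl, rfl⟩ := exists_eq_toPreLimit₂ V x y
    rw [← toPreLimit_refine V (le_goodRefinement f I) Ψ,
      ← toPreLimit_refine V (le_goodRefinement f I) Φ, ← map_add,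
      actFun_toPreLimit V (carries_good f I), actFun_toPreLimit V (carries_good f I),
      actFun_toPreLimit V (carries_good f I), map_add, map_add]
  map_smul' c x := by
    obtain ⟨I, J, h, Ψ, rfl⟩ := exists_good V f x
    rw [← map_smul, actFun_toPreLimit V h, actFun_toPreLimit V h, map_smul, map_smul]
    rfl

theorem actLin_norm (f : thompsonT) (x : PreLimit V) : ‖actLin V f x‖ = ‖x‖ := by
  obtain ⟨I, J, h, Ψ, rfl⟩ := exists_good V f x
  have e : actLin V f (toPreLimit V I Ψ) = toPreLimit V J (h.relabel Ψ) :=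
    actFun_toPreLimit V h Ψ
  rw [e, norm_eq_sqrt_re_inner (𝕜 := ℂ), norm_eq_sqrt_re_inner (𝕜 := ℂ), inner_toPreLimit,
    inner_toPreLimit, Carries.relabel_inner]

/-- The invertible linear map by which `f` acts on classes. -/
def actEquiv (f : thompsonT) : PreLimit V ≃ₗ[ℂ] PreLimit V :=
  LinearEquiv.ofLinearMap (actLin V f) (actLin V f⁻¹)
    (LinearMap.ext fun x => by
      change actFun V f (actFun V f⁻¹ x) = x
      rw [← actFun_mul, mul_inv_cancel, actFun_one])
    (LinearMap.ext fun x => by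
      change actFun V f⁻¹ (actFun V f x) = x
      rw [← actFun_mul, inv_mul_cancel, actFun_one])

/-- The unitary operator by which `f` acts on the semicontinuous limit. -/
def act (f : thompsonT) : Limit V ≃ₗᵢ[ℂ] Limit V :=
  (actEquiv V f).extendOfIsometry
    (UniformSpace.Completion.toComplₗᵢ (𝕜 := ℂ) (E := PreLimit V)).toLinearMap
    (UniformSpace.Completion.toComplₗᵢ (𝕜 := ℂ) (E := PreLimit V)).toLinearMap
    UniformSpace.Completion.denseRange_coe UniformSpace.Completion.denseRange_coe
    (fun x => by
      simp only [LinearIsometry.coe_toLinearMap, LinearIsometry.norm_map]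
      exact actLin_norm V f x)

theorem act_coe (f : thompsonT) (x : PreLimit V) :
    act V f (x : Limit V) = ((actFun V f x : PreLimit V) : Limit V) :=
  LinearEquiv.extendOfIsometry_eq (f := actEquiv V f)
    (e₁ := (UniformSpace.Completion.toComplₗᵢ (𝕜 := ℂ) (E := PreLimit V)).toLinearMap)
    (e₂ := (UniformSpace.Completion.toComplₗᵢ (𝕜 := ℂ) (E := PreLimit V)).toLinearMap)
    _ _ _ x

/-- The unitary representation `ρ ^ V` of Thompson's group on the semicontinuous limit. -/
def rho : thompsonT →* (Limit V ≃ₗᵢ[ℂ] Limit V) where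
  toFun := act V
  map_one' := by
    refine LinearIsometryEquiv.ext fun z => ?_
    induction z using UniformSpace.Completion.induction_on with
    | hp => exact isClosed_eq (act V 1).continuous continuous_id
    | ih x => rw [act_coe, actFun_one]; rfl
  map_mul' f g := by
    refine LinearIsometryEquiv.ext fun z => ?_
    induction z using UniformSpace.Completion.induction_on with
    | hp => exact isClosed_eq (act V (f * g)).continuous (act V f * act V g).continuous
    | ih x =>
      change _ = act V f (act V g x)
      rw [act_coe, act_coe, act_coe, actFun_mul]

/-- The defining property of `ρ ^ V`: if `f` carries `I` to a standard dyadic partition `J`, then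
`ρ ^ V f` maps the class of `Ψ` to the class of the relabelled vector. -/
theorem rho_toLimit {f : thompsonT} {I J : Partition}
    (h : Carries (f : UnitAddCircle ≃ₜ UnitAddCircle) I J) (Ψ : LocalSpace d I) :
    rho V f (toLimit V I Ψ) = toLimit V J (h.relabel Ψ) := by
  change act V f (toPreLimit V I Ψ : PreLimit V) = _
  rw [act_coe, actFun_toPreLimit V h]
  rfl

end Representation

/-! ### Weak discontinuity -/

/-- `f k` converges to the identity uniformly, with respect to the distance of the circle. -/
def ConvergesToId (f : ℕ → thompsonT) : Prop :=
  Filter.Tendsto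
    (fun k => ⨆ z : UnitAddCircle, ‖(f k : UnitAddCircle ≃ₜ UnitAddCircle) z - z‖)
    Filter.atTop (nhds 0)

/-- A unitary representation `ρ` of Thompson's group is weakly discontinuous at the identity if
there are a sequence `f k` converging uniformly to the identity and vectors `Φ`, `Ψ` such that
`⟨Φ, ρ (f k) Ψ⟩` converges to a limit different from `⟨Φ, Ψ⟩`. -/
def WeaklyDiscontinuousAtId {H : Type*} [NormedAddCommGroup H] [InnerProductSpace ℂ H]
    (ρ : thompsonT →* (H ≃ₗᵢ[ℂ] H)) : Prop :=
  ∃ f : ℕ → thompsonT, ConvergesToId f ∧ ∃ (Φ Ψ : H) (L : ℂ),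
    Filter.Tendsto (fun k => inner ℂ Φ (ρ (f k) Ψ)) Filter.atTop (nhds L) ∧ L ≠ inner ℂ Φ Ψ

section Condition

variable {d : ℕ} (V : Qudit d →ₗᵢ[ℂ] Qudit d ⊗[ℂ] Qudit d)

/-- The range of the projection `V V†` in `ℂ ^ d ⊗ ℂ ^ d`. -/
def rangeSubspace : Submodule ℂ (Qudit d ⊗[ℂ] Qudit d) :=
  LinearMap.range (V.toLinearMap ∘ₗ LinearMap.adjoint V.toLinearMap)

/-- The intersection of `𝒱 ⊗ ℂ ^ d` and `ℂ ^ d ⊗ 𝒱` is zero, where `𝒱` is the range of `V V†`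
and both are regarded as subspaces of `(ℂ ^ d ⊗ ℂ ^ d) ⊗ ℂ ^ d`. -/
def TrivialIntersection : Prop :=
  LinearMap.range ((rangeSubspace V).subtype.rTensor (Qudit d)) ⊓
    (LinearMap.range ((rangeSubspace V).subtype.lTensor (Qudit d))).comap
      (TensorProduct.assoc ℂ (Qudit d) (Qudit d) (Qudit d)).toLinearMap = ⊥

/-- The operator `(I ⊗ V†) (V ⊗ I)` on `ℂ ^ d ⊗ ℂ ^ d`, as a continuous linear map. -/
def overlap : Qudit d ⊗[ℂ] Qudit d →L[ℂ] Qudit d ⊗[ℂ] Qudit d :=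
  ((LinearMap.adjoint V.toLinearMap).lTensor (Qudit d) ∘ₗ
    (TensorProduct.assoc ℂ (Qudit d) (Qudit d) (Qudit d)).toLinearMap ∘ₗ
    V.toLinearMap.rTensor (Qudit d)).toContinuousLinearMap

/-- A one-site vector, placed at the only interval `[0, 1]` of the trivial partition. -/
def rootVector (ψ : Qudit d) : LocalSpace d (Partition.uniform 0) :=
  WithLp.toLp 2 fun i => ψ (i ⟨⟨0, 0, one_pos⟩, Partition.mem_uniform.2 rfl⟩)

/-- The vector of the semicontinuous limit determined by the one-site vector `ψ`. -/
def rootState (ψ : Qudit d) : Limit V := toLimit V (Partition.uniform 0) (rootVector ψ)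

theorem inner_rootState (φ ψ : Qudit d) :
    inner ℂ (rootState V φ) (rootState V ψ) = inner ℂ φ ψ := by
  rw [rootState, rootState, inner_toLimit]
  simp only [PiLp.inner_apply, rootVector]
  let _ : Unique (Partition.uniform 0).parts :=
    { default := ⟨⟨0, 0, one_pos⟩, Partition.mem_uniform.2 rfl⟩
      uniq := fun A => by
        obtain ⟨A, hA⟩ := A
        refine Subtype.ext ((Partition.uniform 0).eq_of_mem hA (Partition.mem_uniform.2 rfl)
          (x := 0) ?_ ?_)
        · have h := Partition.mem_uniform.1 hA
          have h' := A.index_lt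
          rw [h] at h'
          have : A.index = 0 := by omega
          simp [Dyadic.mem_iff, this]
        · simp [Dyadic.mem_iff] }
  exact Fintype.sum_equiv (Equiv.funUnique (Partition.uniform 0).parts (Fin d)) _ _ fun _ => rfl

end Condition

end TreeRep

end

open TreeRep

/-! Everything rests on one exact formula. Refine both root vectors to the uniform partition into `2
^ k` intervals and then once more, so that every site `p` carries a copy of `V` with a left and a
right leg. Translation by `2 ^ (-(k + 1))` shifts the legs by half a site: left leg `p` goes to
right leg `p`, and right leg `p` goes to left leg `p + 1`, cyclically. Pairing the shifted state
with the unshifted one therefore joins the right leg of the `V` at `p` in one state to the left leg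
of the `V` at `p` in the other. Each such joint is a copy of the overlap `x = (I ⊗ V†)(V ⊗ I)`, and
the remaining left legs link the copies into a ring (`inner_relabel_refine`).

The ring is a matrix product operator with `2 ^ k` sites whose auxiliary wire is closed by a trace
(`sum_cyclic_prod_eq_trace`). With the wire left open it is a product of `2 ^ k` operators, each a
copy of `x` acting on the wire and one site, so its norm is at most `‖x‖ ^ 2 ^ k`
(`transferPath_bound`). The trace is a sum of `d` diagonal blocks and costs a factor `d`. Refinement
preserves norms, so the matrix element is at most `d ‖φ‖ ‖ψ‖ ‖x‖ ^ 2 ^ k`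
(`norm_inner_translation_le`).

The intersection condition enters only through `‖x‖ < 1` (`norm_overlap_lt_one`). If `x` failed to
shrink a nonzero `u`, then `(V ⊗ I) u` would be fixed by the projection `I ⊗ V V†` and would be a
nonzero vector in both subspaces. Strict contraction of each vector becomes a strict norm bound
because the unit ball is compact in finite dimension.

The matrix elements thus tend to `0`, whereas a unit root vector has inner product `1` with itself;
this is the weak discontinuity. -/

noncomputable section

namespace TreeRep

/-! ### Matrix product operators: norm bound and closing the wire. -/

section Transfer

variable {κ : Type*} [Fintype κ]

/-- A sum over configurations on `n + 1` sites, with the last site split off. -/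
theorem sum_snoc {M : Type*} [AddCommMonoid M] {n : ℕ} (F : (Fin (n + 1) → κ) → M) :
    ∑ s, F s = ∑ z : κ, ∑ t : Fin n → κ, F (Fin.snoc t z) := by
  rw [← (Fin.snocEquiv fun _ => κ).sum_comp F, Fintype.sum_prod_type]
  rfl

variable [DecidableEq κ] (X : κ × κ → κ × κ → ℂ)

/-- The open matrix product operator on `n` sites with the tensor `X` at each site: `s'` and `s` are
the outputs and inputs of the sites, `a` and `b` are the two ends of the auxiliary wire. -/
def transferPath : (n : ℕ) → (Fin n → κ) → (Fin n → κ) → κ → κ → ℂ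
  | 0, _, _, a, b => if a = b then 1 else 0
  | n + 1, s', s, a, b => ∑ c, transferPath n (Fin.init s') (Fin.init s) a c *
      X (c, s' (Fin.last n)) (s (Fin.last n), b)

/-- The open operator is a product of `n` copies of `X`, each acting on the wire and on one site as
the identity on the other sites, so its operator norm is at most `c ^ n`. The squared `ℓ²` form lets
the induction peel off the last site: the bound for `n` sites is used at each fixed output of that
site, and `hX` at each fixed input of the others. -/
theorem transferPath_bound {c : ℝ}
    (hX : ∀ w : κ × κ → ℂ, ∑ p, ‖∑ q, X p q * w q‖ ^ 2 ≤ c ^ 2 * ∑ q, ‖w q‖ ^ 2) :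
    ∀ (n : ℕ) (w : (Fin n → κ) → κ → ℂ),
      ∑ s', ∑ a, ‖∑ s, ∑ b, transferPath X n s' s a b * w s b‖ ^ 2 ≤
        (c ^ n) ^ 2 * ∑ s, ∑ b, ‖w s b‖ ^ 2
  | 0, w => by simp [transferPath]
  | n + 1, w => by
    -- The last copy of `X` acts first: it takes the last input and the right end `b` of the wire to
    -- the last output `z'` and the inner wire label `e`.
    have key : ∀ (z' : κ) (t' : Fin n → κ) (a : κ),
        ∑ s, ∑ b, transferPath X (n + 1) (Fin.snoc t' z') s a b * w s b =
          ∑ t, ∑ e, transferPath X n t' t a e *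
            ∑ q : κ × κ, X (e, z') q * w (Fin.snoc t q.1) q.2 := by
      intro z' t' a
      rw [sum_snoc, Finset.sum_comm]
      refine Finset.sum_congr rfl fun t _ => ?_
      simp only [transferPath, Fin.init_snoc, Fin.snoc_last, Finset.mul_sum, Finset.sum_mul,
        Fintype.sum_prod_type]
      rw [Finset.sum_comm' (t' := Finset.univ) (s' := fun _ => Finset.univ) (by simp)]
      rw [Finset.sum_comm]
      conv_rhs => rw [Finset.sum_comm]
      refine Finset.sum_congr rfl fun z _ => ?_
      rw [Finset.sum_comm]
      exact Finset.sum_congr rfl fun e _ => Finset.sum_congr rfl fun b _ => mul_assoc _ _ _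
    rw [sum_snoc, sum_snoc]
    simp only [key]
    calc _ ≤ ∑ z' : κ, (c ^ n) ^ 2 * ∑ t : Fin n → κ, ∑ e,
            ‖∑ q : κ × κ, X (e, z') q * w (Fin.snoc t q.1) q.2‖ ^ 2 :=
          Finset.sum_le_sum fun z' _ => transferPath_bound hX n fun t e =>
            ∑ q : κ × κ, X (e, z') q * w (Fin.snoc t q.1) q.2
      _ = (c ^ n) ^ 2 * ∑ t : Fin n → κ, ∑ p : κ × κ,
            ‖∑ q : κ × κ, X p q * w (Fin.snoc t q.1) q.2‖ ^ 2 := by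
          rw [← Finset.mul_sum, Finset.sum_comm]
          congr 1
          refine Finset.sum_congr rfl fun t _ => ?_
          rw [Finset.sum_comm, Fintype.sum_prod_type]
      _ ≤ (c ^ n) ^ 2 * ∑ t : Fin n → κ, c ^ 2 * ∑ q : κ × κ, ‖w (Fin.snoc t q.1) q.2‖ ^ 2 := by
          gcongr with t
          exact hX _
      _ = _ := by
          rw [← Finset.mul_sum, ← mul_assoc, ← mul_pow, ← pow_succ]
          congr 1
          simp only [Fintype.sum_prod_type]
          rw [Finset.sum_comm]

/-- Closing the auxiliary wire of the matrix product operator costs a factor `|κ|`. -/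
theorem norm_sum_transferPath_trace_le {c : ℝ} (hc : 0 ≤ c)
    (hX : ∀ w : κ × κ → ℂ, ∑ p, ‖∑ q, X p q * w q‖ ^ 2 ≤ c ^ 2 * ∑ q, ‖w q‖ ^ 2)
    (n : ℕ) (Φ Ψ : EuclideanSpace ℂ (Fin n → κ)) :
    ‖∑ s', ∑ s, (starRingEnd ℂ) (Φ s') * Ψ s * ∑ a, transferPath X n s' s a a‖ ≤
      Fintype.card κ * c ^ n * ‖Φ‖ * ‖Ψ‖ := by
  -- `W a` is the diagonal block of the open operator at wire label `a`, applied to `Ψ`. The trace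
  -- is the sum of these blocks, each handled by Cauchy–Schwarz.
  let W (a : κ) : EuclideanSpace ℂ (Fin n → κ) :=
    WithLp.toLp 2 fun s' => ∑ s, transferPath X n s' s a a * Ψ s
  have hW : ∀ a, ‖W a‖ ≤ c ^ n * ‖Ψ‖ := by
    intro a
    refine le_of_sq_le_sq ?_ (by positivity)
    rw [mul_pow, EuclideanSpace.norm_sq_eq, EuclideanSpace.norm_sq_eq]
    -- Feeding in `Ψ` with the wire fixed to `a` and then keeping only the output wire label `a`
    -- bounds a diagonal block by the whole operator.
    have h := transferPath_bound X hX n fun s b => if b = a then Ψ s else 0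
    have e : ∀ s : Fin n → κ, ∑ b, ‖if b = a then Ψ s else 0‖ ^ 2 = ‖Ψ s‖ ^ 2 := by
      intro s
      rw [Finset.sum_eq_single a (by simp +contextual) (by simp)]
      simp
    simp only [e, mul_ite, mul_zero, Finset.sum_ite_eq', Finset.mem_univ, if_true] at h
    refine le_trans (Finset.sum_le_sum fun s' _ => ?_) h
    exact Finset.single_le_sum (f := fun a' => ‖∑ s, transferPath X n s' s a' a * Ψ s‖ ^ 2)
      (fun _ _ => by positivity) (Finset.mem_univ a)
  have e : ∑ s', ∑ s, (starRingEnd ℂ) (Φ s') * Ψ s * ∑ a, transferPath X n s' s a a =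
      ∑ a, inner ℂ Φ (W a) := by
    simp only [PiLp.inner_apply, RCLike.inner_apply, W, Finset.mul_sum, Finset.sum_mul]
    rw [Finset.sum_comm' (t' := Finset.univ) (s' := fun _ => Finset.univ) (by simp)]
    conv_rhs => rw [Finset.sum_comm]; enter [2, s']; rw [Finset.sum_comm]
    rw [Finset.sum_comm]
    exact Finset.sum_congr rfl fun s' _ => Finset.sum_congr rfl fun s _ =>
      Finset.sum_congr rfl fun a _ => by ring
  rw [e]
  refine (norm_sum_le _ _).trans ((Finset.sum_le_sum (g := fun _ => c ^ n * ‖Φ‖ * ‖Ψ‖)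
    fun a _ => ?_).trans_eq ?_)
  · calc _ ≤ ‖Φ‖ * ‖W a‖ := norm_inner_le_norm _ _
      _ ≤ ‖Φ‖ * (c ^ n * ‖Ψ‖) := by gcongr; exact hW a
      _ = _ := by ring
  · rw [Finset.sum_const, nsmul_eq_mul, Finset.card_univ]
    ring

/-- The arbitrary weight `F` on the two ends of the wire is what makes the induction close:
splitting off the last site absorbs its `X` into a new weight. The same freedom later allows a
closing factor to be put on the ends. -/
theorem sum_prod_eq_sum_transferPath (F : κ → κ → ℂ) :
    ∀ (n : ℕ) (s' s : Fin n → κ),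
      ∑ l : Fin (n + 1) → κ, F (l 0) (l (Fin.last n)) *
          ∏ p : Fin n, X (l p.castSucc, s' p) (s p, l p.succ) =
        ∑ a, ∑ b, F a b * transferPath X n s' s a b
  | 0, s', s => by
    rw [← (Equiv.funUnique (Fin 1) κ).symm.sum_comp]
    simp [transferPath]
  | n + 1, s', s => by
    rw [sum_snoc]
    have h : ∀ (z : κ) (t : Fin (n + 1) → κ),
        F ((Fin.snoc t z : Fin (n + 2) → κ) 0) ((Fin.snoc t z : Fin (n + 2) → κ) (Fin.last _)) *
          ∏ p : Fin (n + 1), X ((Fin.snoc t z : Fin (n + 2) → κ) p.castSucc, s' p)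
            (s p, (Fin.snoc t z : Fin (n + 2) → κ) p.succ) =
        (F (t 0) z * X (t (Fin.last n), s' (Fin.last n)) (s (Fin.last n), z)) *
          ∏ p : Fin n, X (t p.castSucc, Fin.init s' p) (Fin.init s p, t p.succ) := by
      intro z t
      rw [Fin.prod_univ_castSucc, ← Fin.castSucc_zero, Fin.snoc_castSucc, Fin.snoc_last,
        Fin.succ_last, Fin.snoc_last]
      simp only [Fin.snoc_castSucc, ← Fin.castSucc_succ, Fin.init]
      ring
    simp only [h]
    have ih := fun z => sum_prod_eq_sum_transferPath
      (fun a e => F a z * X (e, s' (Fin.last n)) (s (Fin.last n), z)) n (Fin.init s') (Fin.init s)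
    simp only [ih, transferPath, Finset.mul_sum]
    rw [Finset.sum_comm]
    exact Finset.sum_congr rfl fun a _ => Finset.sum_congr rfl fun b _ =>
      Finset.sum_congr rfl fun e _ => by ring

/-- Cut the ring at its last site. The other sites form an open path, and the `X` of the last site,
which joins the end of that path back to label `l 0`, serves as the weight on its two ends. -/
theorem sum_cyclic_prod_eq_trace {n : ℕ} [NeZero n] (s' s : Fin n → κ) :
    ∑ l : Fin n → κ, ∏ p : Fin n, X (l p, s' p) (s p, l (p + 1)) =
      ∑ a, transferPath X n s' s a a := by
  obtain ⟨n, rfl⟩ := Nat.exists_eq_succ_of_ne_zero (NeZero.ne n)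
  have h := sum_prod_eq_sum_transferPath X
    (fun a b => X (b, s' (Fin.last n)) (s (Fin.last n), a)) n (Fin.init s') (Fin.init s)
  simp only [transferPath, Fin.init] at h ⊢
  calc _ = _ := Finset.sum_congr rfl fun l _ => by
        rw [Fin.prod_univ_castSucc, Fin.last_add_one, mul_comm]
        simp only [Fin.coeSucc_eq_succ]
    _ = _ := h
    _ = _ := Finset.sum_congr rfl fun a _ => Finset.sum_congr rfl fun b _ => mul_comm _ _

end Transfer

/-! ### The overlap operator: strict contraction and matrix elements. -/

section Overlap

variable {d : ℕ} (V : Qudit d →ₗᵢ[ℂ] Qudit d ⊗[ℂ] Qudit d)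

/-- With `L = I ⊗ V`, the overlap is the isometry `V ⊗ I` followed by the adjoint of `L`. It can
preserve the norm of `u` only if `(V ⊗ I) u` lies in the range of `L`, which the intersection
condition forbids unless `u = 0`. -/
theorem norm_overlap_lt_one (hV : TrivialIntersection V) : ‖overlap V‖ < 1 := by
  set L : Qudit d ⊗[ℂ] Qudit d →ₗ[ℂ] Qudit d ⊗[ℂ] (Qudit d ⊗[ℂ] Qudit d) :=
    V.toLinearMap.lTensor (Qudit d) with hL
  set L' : Qudit d ⊗[ℂ] (Qudit d ⊗[ℂ] Qudit d) →ₗ[ℂ] Qudit d ⊗[ℂ] Qudit d :=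
    (LinearMap.adjoint V.toLinearMap).lTensor (Qudit d) with hL'
  have hadj : ∀ z u, inner ℂ z (L u) = inner ℂ (L' z) u := by
    intro z u
    rw [hL', ← LinearMap.adjoint_lTensor]
    exact (LinearMap.adjoint_inner_left (𝕜 := ℂ) (E := Qudit d ⊗[ℂ] Qudit d)
      (F := Qudit d ⊗[ℂ] (Qudit d ⊗[ℂ] Qudit d)) L u z).symm
  have hLnorm : ∀ u, ‖L u‖ = ‖u‖ := (V.lTensor (Qudit d)).norm_map
  have hV' : LinearMap.adjoint V.toLinearMap ∘ₗ V.toLinearMap = LinearMap.id := by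
    refine LinearMap.ext fun a => ext_inner_left ℂ fun b => ?_
    rw [LinearMap.comp_apply, LinearMap.adjoint_inner_right]
    exact V.inner_map_map b a
  -- Pythagoras for the orthogonal projection `L L'` onto the range of `L`.
  have hdist : ∀ z, ‖z - L (L' z)‖ ^ 2 = ‖z‖ ^ 2 - ‖L' z‖ ^ 2 := by
    intro z
    refine (norm_sub_sq (𝕜 := ℂ) z (L (L' z))).trans ?_
    have h : RCLike.re (inner ℂ (L' z) (L' z)) = ‖L' z‖ ^ 2 :=
      inner_self_eq_norm_sq (𝕜 := ℂ) (L' z)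
    rw [hLnorm, hadj, h]
    ring
  have hx : ∀ u, overlap V u = L' (TensorProduct.assoc ℂ _ _ _ (V.rTensor (Qudit d) u)) :=
    fun u => rfl
  have hstrict : ∀ u, u ≠ 0 → ‖overlap V u‖ < ‖u‖ := by
    intro u hu
    set z := TensorProduct.assoc ℂ (Qudit d) (Qudit d) (Qudit d) (V.rTensor (Qudit d) u) with hz
    have hzu : ‖z‖ = ‖u‖ := by
      rw [hz, TensorProduct.norm_assoc, LinearIsometry.norm_map]
    rw [hx, ← hz, ← hzu]
    by_contra hlt
    have h0 : ‖z - L (L' z)‖ ^ 2 = 0 := by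
      have : ‖z‖ ^ 2 ≤ ‖L' z‖ ^ 2 := by gcongr; exact not_lt.1 hlt
      have h' := hdist z
      nlinarith [sq_nonneg ‖z - L (L' z)‖]
    have hfix : z = L (L' z) := by
      rw [sq_eq_zero_iff, norm_eq_zero, sub_eq_zero] at h0
      exact h0
    have hmem : V.rTensor (Qudit d) u ∈
        LinearMap.range ((rangeSubspace V).subtype.rTensor (Qudit d)) ⊓
        (LinearMap.range ((rangeSubspace V).subtype.lTensor (Qudit d))).comap
          (TensorProduct.assoc ℂ (Qudit d) (Qudit d) (Qudit d)).toLinearMap := by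
      -- The subspace is defined as the range of `V V†`; it contains the range of `V` because `V a =
      -- V V† (V a)`. Factoring `V` through it exhibits the two required preimages.
      have hfac : ∃ V₀ : Qudit d →ₗ[ℂ] rangeSubspace V,
          (rangeSubspace V).subtype ∘ₗ V₀ = V.toLinearMap := by
        refine ⟨V.toLinearMap.codRestrict _ fun a => ⟨V a, ?_⟩, LinearMap.subtype_comp_codRestrict _ _ _⟩
        have := LinearMap.congr_fun hV' a
        exact congrArg V this
      obtain ⟨V₀, hV₀⟩ := hfac
      refine ⟨⟨V₀.rTensor (Qudit d) u, ?_⟩, ⟨V₀.lTensor (Qudit d) (L' z), ?_⟩⟩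
      · rw [← LinearMap.comp_apply, ← LinearMap.rTensor_comp, hV₀]
        rfl
      · rw [← LinearMap.comp_apply, ← LinearMap.lTensor_comp, hV₀]
        exact hfix.symm
    rw [hV, Submodule.mem_bot] at hmem
    exact hu (norm_eq_zero.1 (by rw [← (V.rTensor (Qudit d)).norm_map, hmem, norm_zero]))
  -- The norm is attained on the compact closed unit ball. A maximizer equal to `0` can occur only
  -- when the operator vanishes, so that case is harmless.
  obtain ⟨u, hu, hmax⟩ := (isCompact_closedBall (0 : Qudit d ⊗[ℂ] Qudit d) 1).exists_isMaxOn
    ⟨0, by simp⟩ (overlap V).continuous.norm.continuousOn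
  have hle : ‖overlap V‖ ≤ ‖overlap V u‖ :=
    ContinuousLinearMap.opNorm_le_of_unit_norm (norm_nonneg _) fun w hw =>
      hmax (by simp [hw])
  refine hle.trans_lt ?_
  by_cases h0 : u = 0
  · simp [h0]
  · exact (hstrict u h0).trans_le (by simpa using hu)

/-- The matrix element `⟨p₁ ⊗ p₂, x (q₁ ⊗ q₂)⟩` of the overlap `x` in the standard basis. -/
def overlapMatrix (p q : Fin d × Fin d) : ℂ :=
  ∑ r, isometryTensor V p.1 r q.1 * star (isometryTensor V r q.2 p.2)

theorem map_single_eq (a : Fin d) :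
    V (EuclideanSpace.single a 1) = ∑ b, ∑ c, isometryTensor V b c a •
      ((EuclideanSpace.single b (1 : ℂ) : Qudit d) ⊗ₜ[ℂ] EuclideanSpace.single c (1 : ℂ)) := by
  let e := EuclideanSpace.basisFun (Fin d) ℂ
  have h := (e.tensorProduct e).sum_repr' (V (EuclideanSpace.single a 1))
  rw [Fintype.sum_prod_type] at h
  simpa [e, isometryTensor, OrthonormalBasis.tensorProduct_apply] using h.symm

/-- `V` sends `q.1` to a sum over `b ⊗ c`; pairing with `p.1` selects `b`, while moving `V†` across
the inner product pairs `c ⊗ q.2` with `V p.2`, hence the conjugated entry. -/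
theorem overlapMatrix_eq (p q : Fin d × Fin d) :
    overlapMatrix V p q =
      inner ℂ ((EuclideanSpace.single p.1 (1 : ℂ) : Qudit d) ⊗ₜ[ℂ]
          (EuclideanSpace.single p.2 (1 : ℂ) : Qudit d))
        (overlap V ((EuclideanSpace.single q.1 (1 : ℂ) : Qudit d) ⊗ₜ[ℂ]
          (EuclideanSpace.single q.2 (1 : ℂ) : Qudit d))) := by
  have hx : overlap V ((EuclideanSpace.single q.1 (1 : ℂ) : Qudit d) ⊗ₜ[ℂ]
      (EuclideanSpace.single q.2 (1 : ℂ) : Qudit d)) =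
      ∑ b, ∑ c, isometryTensor V b c q.1 • ((EuclideanSpace.single b (1 : ℂ) : Qudit d) ⊗ₜ[ℂ]
        LinearMap.adjoint V.toLinearMap ((EuclideanSpace.single c (1 : ℂ) : Qudit d) ⊗ₜ[ℂ]
          (EuclideanSpace.single q.2 (1 : ℂ) : Qudit d))) := by
    change (LinearMap.adjoint V.toLinearMap).lTensor (Qudit d)
      (TensorProduct.assoc ℂ _ _ _ (V (EuclideanSpace.single q.1 1) ⊗ₜ[ℂ] _)) = _
    rw [map_single_eq]
    simp only [TensorProduct.sum_tmul, TensorProduct.smul_tmul', map_sum,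
      TensorProduct.assoc_tmul, LinearMap.lTensor_tmul]
    rfl
  have hadj : ∀ c, inner ℂ (EuclideanSpace.single p.2 (1 : ℂ) : Qudit d)
      (LinearMap.adjoint V.toLinearMap ((EuclideanSpace.single c (1 : ℂ) : Qudit d) ⊗ₜ[ℂ]
          (EuclideanSpace.single q.2 (1 : ℂ) : Qudit d))) =
      star (isometryTensor V c q.2 p.2) := by
    intro c
    rw [LinearMap.adjoint_inner_right, isometryTensor]
    exact (inner_conj_symm (𝕜 := ℂ) _ _).symm
  rw [hx]
  have hsmul : ∀ (c : ℂ) (y z : Qudit d ⊗[ℂ] Qudit d), inner ℂ y (c • z) = c * inner ℂ y z :=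
    fun c y z => inner_smul_right y z c
  simp only [inner_sum, hsmul, TensorProduct.inner_tmul, hadj]
  rw [Finset.sum_eq_single p.1]
  · simp [overlapMatrix]
  · intro b _ hb
    simp [EuclideanSpace.inner_single_left, hb]
  · simp

/-- Parseval in the product basis turns the operator norm into the coordinate hypothesis of
`transferPath_bound`. -/
theorem overlapMatrix_bound (w : Fin d × Fin d → ℂ) :
    ∑ p, ‖∑ q, overlapMatrix V p q * w q‖ ^ 2 ≤ ‖overlap V‖ ^ 2 * ∑ q, ‖w q‖ ^ 2 := by
  let e := (EuclideanSpace.basisFun (Fin d) ℂ).tensorProduct (EuclideanSpace.basisFun (Fin d) ℂ)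
  have he : ∀ p q, overlapMatrix V p q = inner ℂ (e p) (overlap V (e q)) := by
    intro p q
    simp [overlapMatrix_eq, e, OrthonormalBasis.tensorProduct_apply']
  let u := ∑ q, w q • e q
  have h1 : ∀ p, ∑ q, overlapMatrix V p q * w q = inner ℂ (e p) (overlap V u) := by
    intro p
    simp only [u, map_sum, map_smul, inner_sum, inner_smul_right, he]
    exact Finset.sum_congr rfl fun q _ => mul_comm _ _
  have h2 : ∀ q, w q = inner ℂ (e q) u := by
    intro q
    simp [u, inner_sum, inner_smul_right, e.inner_eq_ite]
  simp only [h1]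
  rw [e.sum_sq_norm_inner_right, Finset.sum_congr rfl fun q _ => by rw [h2 q],
    e.sum_sq_norm_inner_right, ← mul_pow]
  gcongr
  exact (overlap V).le_opNorm u

end Overlap

/-! ### Uniform partitions and the half-site shift. -/

section Uniform

/-- The intervals of the uniform partition, numbered from left to right. -/
def uniformEquiv (k : ℕ) : Fin (2 ^ k) ≃ (Partition.uniform k).parts where
  toFun p := ⟨⟨k, p, p.2⟩, Partition.mem_uniform.2 rfl⟩
  invFun A := ⟨A.1.index, A.1.index_lt.trans_eq (by rw [Partition.mem_uniform.1 A.2])⟩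
  left_inv _ := rfl
  right_inv A := Subtype.ext (Dyadic.ext (Partition.mem_uniform.1 A.2).symm rfl)

/-- The left half of an interval of the uniform partition. -/
def leftHalf {k : ℕ} (A : (Partition.uniform k).parts) : (Partition.uniform (k + 1)).parts :=
  ⟨A.1.left, Partition.mem_uniform.2 (congrArg (· + 1) (Partition.mem_uniform.1 A.2))⟩

/-- The right half of an interval of the uniform partition. -/
def rightHalf {k : ℕ} (A : (Partition.uniform k).parts) : (Partition.uniform (k + 1)).parts :=
  ⟨A.1.right, Partition.mem_uniform.2 (congrArg (· + 1) (Partition.mem_uniform.1 A.2))⟩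

/-- Each interval of the uniform partition at level `k + 1` is a half of one at level `k`. -/
def halvesEquiv (k : ℕ) : Fin (2 ^ k) ⊕ Fin (2 ^ k) ≃ (Partition.uniform (k + 1)).parts :=
  Equiv.ofBijective (Sum.elim (fun p => leftHalf (uniformEquiv k p))
    fun p => rightHalf (uniformEquiv k p)) <| by
    constructor
    · rintro (p | p) (q | q) h <;>
      · have h' := congrArg (fun A => A.1.index) h
        simp only [Sum.elim_inl, Sum.elim_inr, leftHalf, rightHalf, Dyadic.left, Dyadic.right,
          uniformEquiv, Equiv.coe_fn_mk] at h'
        first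
          | exact congrArg _ (Fin.ext (by omega))
          | omega
    · rintro ⟨A, hA⟩
      have hl := Partition.mem_uniform.1 hA
      have hlt := A.index_lt
      rw [hl, pow_succ] at hlt
      rcases Nat.even_or_odd' A.index with ⟨m, hm | hm⟩
      · exact ⟨Sum.inl ⟨m, by omega⟩, Subtype.ext (Dyadic.ext hl.symm hm.symm)⟩
      · exact ⟨Sum.inr ⟨m, by omega⟩, Subtype.ext (Dyadic.ext hl.symm hm.symm)⟩

theorem uniform_depth_le (k : ℕ) : (Partition.uniform k).depth ≤ k :=
  Finset.sup_le fun _ hA => (Partition.mem_uniform.1 hA).le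

theorem uniform_mono {k l : ℕ} (h : k ≤ l) : Partition.uniform k ≤ Partition.uniform l :=
  Partition.le_uniform _ ((uniform_depth_le k).trans h)

/-- Between consecutive levels every tree of the forest has a single inner node, so its contraction
is one entry of `v`. -/
theorem forestAmplitude_uniform_succ {κ : Type*} [Fintype κ] [DecidableEq κ]
    (v : κ → κ → κ → ℂ) (k : ℕ) (i : (Partition.uniform k).parts → κ)
    (j : (Partition.uniform (k + 1)).parts → κ) :
    forestAmplitude v (Partition.uniform k) (Partition.uniform (k + 1)) i j =
      ∏ A, v (j (leftHalf A)) (j (rightHalf A)) (i A) := by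
  refine Finset.prod_congr rfl fun A _ => ?_
  have hA : (A : Dyadic) ∉ (Partition.uniform (k + 1)).parts := by
    rw [Partition.mem_uniform, Partition.mem_uniform.1 A.2]
    omega
  have hl : contract v (Partition.uniform (k + 1)) (leafCovector j) A.1.left =
      Pi.single (j (leftHalf A)) 1 :=
    (contract_leaf v _ (leftHalf A).2).trans (extend_of_mem _ (leftHalf A))
  have hr : contract v (Partition.uniform (k + 1)) (leafCovector j) A.1.right =
      Pi.single (j (rightHalf A)) 1 :=
    (contract_leaf v _ (rightHalf A).2).trans (extend_of_mem _ (rightHalf A))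
  rw [contract_node v _ (Partition.above_of_le (uniform_mono k.le_succ)
    (Partition.above_of_mem A.2)) hA, hl, hr]
  simp [Pi.single_apply]

theorem translation_mapsAffinely {k : ℕ} {A B : Dyadic} (hA : A.level = k) (hB : B.level = k)
    (h : B.index = (A.index + 1) % 2 ^ k) :
    MapsAffinely (translation k : UnitAddCircle ≃ₜ UnitAddCircle) A B := by
  intro t _
  -- The quotient counts turns around the circle: after division by `2 ^ k` it is an integer shift,
  -- which is zero in `ℝ / ℤ`.
  have hq : (B.index : ℝ) = A.index + 1 - 2 ^ k * (((A.index + 1) / 2 ^ k : ℕ) : ℝ) := by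
    have e := Nat.mod_add_div (A.index + 1) (2 ^ k)
    rw [← h] at e
    have e' : (B.index : ℝ) + 2 ^ k * (((A.index + 1) / 2 ^ k : ℕ) : ℝ) = A.index + 1 := by
      exact_mod_cast e
    linarith
  change (((A.index + t) / 2 ^ A.level : ℝ) : UnitAddCircle) + ((1 / 2 ^ k : ℝ) : UnitAddCircle) = _
  have e : ((B.index : ℝ) + t) / 2 ^ B.level =
      (A.index + t) / 2 ^ A.level + 1 / 2 ^ k - (((A.index + 1) / 2 ^ k : ℕ) : ℝ) := by
    rw [hq, hA, hB]
    field_simp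
    ring
  rw [e, AddCircle.coe_sub, AddCircle.coe_add, eq_comm, sub_eq_self]
  exact (AddCircle.coe_eq_zero_iff (1 : ℝ)).2 ⟨((A.index + 1) / 2 ^ k : ℕ), by
    rw [zsmul_eq_mul, mul_one, Int.cast_natCast]⟩

theorem translation_carries (k : ℕ) :
    Carries (translation k : UnitAddCircle ≃ₜ UnitAddCircle) (Partition.uniform k)
      (Partition.uniform k) := fun A hA =>
  ⟨⟨k, (A.index + 1) % 2 ^ k, Nat.mod_lt _ (by positivity)⟩, Partition.mem_uniform.2 rfl,
    translation_mapsAffinely (Partition.mem_uniform.1 hA) rfl rfl⟩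

theorem image_leftHalf (k : ℕ) (p : Fin (2 ^ k)) :
    (translation_carries (k + 1)).image (leftHalf (uniformEquiv k p)) =
      rightHalf (uniformEquiv k p) := by
  refine (translation_carries (k + 1)).image_eq (translation_mapsAffinely rfl rfl ?_)
  have := p.2
  change 2 * (p : ℕ) + 1 = (2 * p + 1) % 2 ^ (k + 1)
  rw [Nat.mod_eq_of_lt]
  rw [pow_succ]
  omega

/-- This is where neighbouring sites get coupled. Addition in `Fin (2 ^ k)` wraps at the last site,
so the resulting chain is a ring; for `k = 0` the only site is its own neighbour. -/
theorem image_rightHalf (k : ℕ) (p : Fin (2 ^ k)) :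
    (translation_carries (k + 1)).image (rightHalf (uniformEquiv k p)) =
      leftHalf (uniformEquiv k (p + 1)) := by
  refine (translation_carries (k + 1)).image_eq (translation_mapsAffinely rfl rfl ?_)
  change 2 * ((p + 1 : Fin (2 ^ k)) : ℕ) = (2 * p + 1 + 1) % 2 ^ (k + 1)
  rw [Fin.val_add, Fin.val_one', Nat.add_mod_mod, pow_succ', ← Nat.mul_mod_mul_left]
  rfl

end Uniform

/-! ### Matrix elements of the translations. -/

section MatrixElement

variable {d : ℕ} (V : Qudit d →ₗᵢ[ℂ] Qudit d ⊗[ℂ] Qudit d)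

/-- A vector of the uniform partition, with the tensor factors numbered from left to right. -/
def siteVector {k : ℕ} (Φ : LocalSpace d (Partition.uniform k)) :
    EuclideanSpace ℂ (Fin (2 ^ k) → Fin d) :=
  WithLp.toLp 2 fun s => Φ (s ∘ (uniformEquiv k).symm)

theorem norm_siteVector {k : ℕ} (Φ : LocalSpace d (Partition.uniform k)) :
    ‖siteVector Φ‖ = ‖Φ‖ := by
  rw [EuclideanSpace.norm_eq, EuclideanSpace.norm_eq]
  congr 1
  exact Fintype.sum_equiv ((uniformEquiv k).arrowCongr (Equiv.refl (Fin d))) _ _ fun _ => rfl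

theorem refine_uniform_succ_apply {k : ℕ} (Φ : LocalSpace d (Partition.uniform k))
    (j : (Partition.uniform (k + 1)).parts → Fin d) :
    refine V _ _ (uniform_mono k.le_succ) Φ j =
      ∑ s, (∏ p, isometryTensor V (j (leftHalf (uniformEquiv k p)))
        (j (rightHalf (uniformEquiv k p))) (s p)) * siteVector Φ s := by
  rw [refine_apply]
  symm
  refine Fintype.sum_equiv ((uniformEquiv k).arrowCongr (Equiv.refl (Fin d))) _ _ fun s => ?_
  rw [forestAmplitude_uniform_succ]
  congr 1
  exact Fintype.prod_equiv (uniformEquiv k) _ _ fun p => by simp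

theorem sum_mul_conj_sum {γ σ : Type*} [Fintype γ] [Fintype σ] (f g : γ → σ → ℂ) (a b : σ → ℂ) :
    ∑ c, (∑ s, f c s * a s) * (starRingEnd ℂ) (∑ s, g c s * b s) =
      ∑ s', ∑ s, (starRingEnd ℂ) (b s') * a s * ∑ c, f c s * (starRingEnd ℂ) (g c s') := by
  simp only [map_sum, Finset.sum_mul_sum]
  simp only [Finset.mul_sum]
  rw [Finset.sum_comm, Finset.sum_congr rfl fun s _ => Finset.sum_comm, Finset.sum_comm]
  refine Finset.sum_congr rfl fun s' _ => Finset.sum_congr rfl fun s _ =>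
    Finset.sum_congr rfl fun c _ => ?_
  rw [map_mul]
  ring

/-- Split a configuration of the halves into left labels `l` and right labels. Each right label
occurs in exactly one `V` of either state, and summing over it produces an overlap entry; each left
label joins two neighbouring entries. The translated state stands in the conjugate-linear slot, so
that `x` appears rather than its complex conjugate. -/
theorem inner_relabel_refine {k : ℕ} (Φ Ψ : LocalSpace d (Partition.uniform k)) :
    inner ℂ ((translation_carries (k + 1)).relabel (refine V _ _ (uniform_mono k.le_succ) Ψ))
        (refine V _ _ (uniform_mono k.le_succ) Φ) =
      ∑ s', ∑ s, (starRingEnd ℂ) (siteVector Ψ s') * siteVector Φ s *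
        ∑ l : Fin (2 ^ k) → Fin d,
          ∏ p, overlapMatrix V (l p, s' p) (s p, l (p + 1)) := by
  simp only [PiLp.inner_apply, RCLike.inner_apply, Carries.relabel_apply,
    refine_uniform_succ_apply, Function.comp_apply, image_leftHalf, image_rightHalf]
  rw [← ((halvesEquiv k).arrowCongr (Equiv.refl (Fin d))).sum_comp,
    ← (Equiv.sumArrowEquivProdArrow (Fin (2 ^ k)) (Fin (2 ^ k)) (Fin d)).symm.sum_comp]
  have hl : ∀ (c : (Fin (2 ^ k) → Fin d) × (Fin (2 ^ k) → Fin d)) p,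
      ((halvesEquiv k).arrowCongr (Equiv.refl (Fin d)))
        ((Equiv.sumArrowEquivProdArrow _ _ _).symm c) (leftHalf (uniformEquiv k p)) = c.1 p := by
    intro c p
    change Sum.elim c.1 c.2 ((halvesEquiv k).symm (halvesEquiv k (Sum.inl p))) = c.1 p
    simp
  have hr : ∀ (c : (Fin (2 ^ k) → Fin d) × (Fin (2 ^ k) → Fin d)) p,
      ((halvesEquiv k).arrowCongr (Equiv.refl (Fin d)))
        ((Equiv.sumArrowEquivProdArrow _ _ _).symm c) (rightHalf (uniformEquiv k p)) = c.2 p := by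
    intro c p
    change Sum.elim c.1 c.2 ((halvesEquiv k).symm (halvesEquiv k (Sum.inr p))) = c.2 p
    simp
  -- The product over sites of the inner sums defining `overlapMatrix` is expanded into one sum over
  -- all right labels `c.2`.
  have hexp : ∀ s' s : Fin (2 ^ k) → Fin d,
      ∑ l : Fin (2 ^ k) → Fin d, ∏ p, overlapMatrix V (l p, s' p) (s p, l (p + 1)) =
        ∑ c : (Fin (2 ^ k) → Fin d) × (Fin (2 ^ k) → Fin d),
          (∏ p, isometryTensor V (c.1 p) (c.2 p) (s p)) *
            (starRingEnd ℂ) (∏ p, isometryTensor V (c.2 p) (c.1 (p + 1)) (s' p)) := by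
    intro s' s
    rw [Fintype.sum_prod_type]
    refine Finset.sum_congr rfl fun l _ => ?_
    simp only [overlapMatrix]
    rw [Fintype.prod_sum]
    simp only [Finset.prod_mul_distrib, map_prod, starRingEnd_apply]
  simp only [hl, hr, hexp]
  exact sum_mul_conj_sum _ _ _ _

/-- Level `k + 1` is the first uniform level preserved by this translation, and its last refinement
step has `2 ^ k` sites, hence the exponent. The constant is free of `k` because refinement is
isometric. -/
theorem norm_inner_translation_le (k : ℕ) (φ ψ : Qudit d) :
    ‖inner ℂ (rootState V φ) (rho V (translation (k + 1)) (rootState V ψ))‖ ≤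
      d * ‖rootVector φ‖ * ‖rootVector ψ‖ * ‖overlap V‖ ^ 2 ^ k := by
  have hroot : ∀ χ : Qudit d, rootState V χ = toLimit V (Partition.uniform (k + 1))
      (refine V _ _ (uniform_mono k.le_succ)
        (refine V _ _ (uniform_mono k.zero_le) (rootVector χ))) := by
    intro χ
    simp only [rootState, toLimit, toPreLimit_refine]
  -- The norm is insensitive to exchanging the two slots, which brings the translated state to the
  -- left as in `inner_relabel_refine`.
  rw [hroot φ, hroot ψ, rho_toLimit V (translation_carries (k + 1)), inner_toLimit,
    norm_inner_symm, inner_relabel_refine]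
  simp only [sum_cyclic_prod_eq_trace (overlapMatrix V)]
  refine (norm_sum_transferPath_trace_le _ (norm_nonneg (overlap V))
    (overlapMatrix_bound V) _ _ _).trans_eq ?_
  rw [norm_siteVector, norm_siteVector, LinearIsometry.norm_map, LinearIsometry.norm_map,
    Fintype.card_fin]
  ring

theorem tendsto_pow_two_pow {c : ℝ} (h0 : 0 ≤ c) (h1 : c < 1) :
    Filter.Tendsto (fun k : ℕ => c ^ 2 ^ k) Filter.atTop (nhds 0) :=
  (tendsto_pow_atTop_nhds_zero_of_lt_one h0 h1).comp
    (tendsto_pow_atTop_atTop_of_one_lt one_lt_two)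

theorem convergesToId_translation : ConvergesToId translation := by
  have h : ∀ k, (⨆ z : UnitAddCircle,
      ‖(translation k : UnitAddCircle ≃ₜ UnitAddCircle) z - z‖) ≤ (1 / 2) ^ k := by
    intro k
    refine ciSup_le fun z => ?_
    change ‖z + ((1 / 2 ^ k : ℝ) : UnitAddCircle) - z‖ ≤ _
    rw [add_sub_cancel_left, UnitAddCircle.norm_eq]
    -- The circle norm is the distance to the nearest integer, and comparison with the integer `0`
    -- covers every `k`, including the full turn at `k = 0`.
    have h0 := round_le ((1 : ℝ) / 2 ^ k) 0
    have hpos : (0 : ℝ) ≤ 1 / 2 ^ k := by positivity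
    rw [Int.cast_zero, sub_zero, abs_of_nonneg hpos] at h0
    exact h0.trans_eq (one_div_pow _ _).symm
  exact squeeze_zero (fun k => Real.iSup_nonneg fun _ => norm_nonneg _) h
    (tendsto_pow_atTop_nhds_zero_of_lt_one (by norm_num) (by norm_num))

end MatrixElement

end TreeRep

end

theorem lemma1 (d : ℕ) (hd : 0 < d) (V : Qudit d →ₗᵢ[ℂ] Qudit d ⊗[ℂ] Qudit d)
    (hV : TrivialIntersection V) :
    WeaklyDiscontinuousAtId (rho V) ∧
    ConvergesToId translation ∧
    ‖overlap V‖ < 1 ∧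
    ∀ φ ψ : Qudit d,
      inner ℂ (rootState V φ) (rootState V ψ) = inner ℂ φ ψ ∧
      Filter.Tendsto (fun k => inner ℂ (rootState V φ) (rho V (translation k) (rootState V ψ)))
        Filter.atTop (nhds 0) ∧
      ∃ C : ℝ, ∀ k : ℕ,
        ‖inner ℂ (rootState V φ) (rho V (translation (k + 1)) (rootState V ψ))‖ ≤
          C * ‖overlap V‖ ^ 2 ^ k := by
  have hlt := norm_overlap_lt_one V hV
  have hlim : ∀ φ ψ : Qudit d, Filter.Tendsto
      (fun k => inner ℂ (rootState V φ) (rho V (translation k) (rootState V ψ)))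
      Filter.atTop (nhds 0) := by
    intro φ ψ
    -- The bound concerns translation by `2 ^ (-(k + 1))`; dropping the first term does not affect
    -- the limit.
    rw [← Filter.tendsto_add_atTop_iff_nat 1]
    refine squeeze_zero_norm (fun k => norm_inner_translation_le V k φ ψ) ?_
    simpa only [mul_zero] using
      (tendsto_pow_two_pow (norm_nonneg (overlap V)) hlt).const_mul
        (d * ‖rootVector φ‖ * ‖rootVector ψ‖)
  refine ⟨⟨translation, convergesToId_translation, ?_⟩, convergesToId_translation, hlt,
    fun φ ψ => ⟨inner_rootState V φ ψ, hlim φ ψ, _, fun k => norm_inner_translation_le V k φ ψ⟩⟩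
  -- A unit vector, available since `d` is positive: its root state has inner product `1` with
  -- itself, unlike the limit `0`.
  let e : Qudit d := EuclideanSpace.single ⟨0, hd⟩ 1
  refine ⟨rootState V e, rootState V e, 0, hlim e e, ?_⟩
  have hne : inner ℂ e e = (1 : ℂ) := by simp [e]
  rw [inner_rootState, hne]
  exact zero_ne_one
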